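/- Let $k$ be an algebraically closed field of arbitrary characteristic, and let $D=\sum_{i=1}^{\ell}H_i$ be a reduced effective divisor on $\mathbb P^n_k$, where $H_1,\dots,H_\ell$ are distinct irreducible hypersurfaces and $H_i$ is defined by an irreducible homogeneous polynomial $h_i\in k[x_0,\dots,x_n]$. Suppose that $D$ is normal crossing in codimension two: there is a closed subset $S\subset\mathbb P^n_k$ of codimension at least $3$ such that $D|_{\mathbb P^n_k\setminus S}$ is a normal crossing divisor, i.e. étale-locally around every point of $\mathbb P^n_k\setminus S$ the divisor $D$ is defined by the product of a (possibly empty) subset of a local system of parameters. Let $\omega\in H^0(\mathbb P^n_k,\Omega^1_{\mathbb P^n_k}(\log D))$, i.e. $\omega$ is a rational $1$-form on $\mathbb P^n_k$ such that, for every point $x$ and every local equation $h\in\mathcal O_{\mathbb P^n_k,x}$ of $D$, both $h\,\omega$ and $h\,d\omega$ are germs of regular differential forms at $x$. Then there are constants $\lambda_1,\dots,\lambda_\ell\in k$ such that $$\sum_{i=1}^{\ell}\lambda_i\deg(H_i)=0 \quad\text{in } k$$ and, in the homogeneous coordinates $x_0,\dots,x_n$ (that is, after pulling back to rational $1$-forms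 on $\mathbb A^{n+1}_k$), $$\omega=\sum_{i=1}^{\ell}\lambda_i\,\frac{dh_i}{h_i}.$$ -/

import Mathlib

open KaehlerDifferential

namespace LogForms

noncomputable section

universe u

section ExteriorDerivative

variable (R A : Type*) [CommRing R] [CommRing A] [Algebra R A]

/-- The module `Ω²_{A/R}` of Kähler 2-forms, the second exterior power of `Ω¹_{A/R}`. -/
abbrev TwoForms : Type _ := ⋀[A]^2 (Ω[A⁄R])

variable {R A}

/-- The wedge product of two 1-forms. -/
def wedge (α β : Ω[A⁄R]) : TwoForms R A := exteriorPower.ιMulti A 2 ![α, β]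

theorem wedge_add_left (α α' β : Ω[A⁄R]) : wedge (α + α') β = wedge α β + wedge α' β := by
  have e : ∀ γ : Ω[A⁄R], Function.update ![α, β] 0 γ = ![γ, β] := fun γ => by
    funext i; fin_cases i <;> simp
  have h := (exteriorPower.ιMulti A 2 (M := Ω[A⁄R])).map_update_add ![α, β] 0 α α'
  rwa [e, e, e] at h

theorem wedge_smul_left (a : A) (α β : Ω[A⁄R]) : wedge (a • α) β = a • wedge α β := by
  have e : ∀ γ : Ω[A⁄R], Function.update ![α, β] 0 γ = ![γ, β] := fun γ => by
    funext i; fin_cases i <;> simp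
  have h := (exteriorPower.ιMulti A 2 (M := Ω[A⁄R])).map_update_smul ![α, β] 0 a α
  rwa [e, e] at h

theorem wedge_self (α : Ω[A⁄R]) : wedge α α = 0 :=
  (exteriorPower.ιMulti A 2 (M := Ω[A⁄R])).map_eq_zero_of_eq ![α, α]
    (i := 0) (j := 1) (by simp) (by simp)

theorem wedge_swap (α β : Ω[A⁄R]) : wedge α β = - wedge β α := by
  have h := (exteriorPower.ιMulti A 2 (M := Ω[A⁄R])).map_swap ![β, α]
    (i := 0) (j := 1) (by simp)
  have e : (![β, α] ∘ (Equiv.swap (0 : Fin 2) 1) : Fin 2 → Ω[A⁄R]) = ![α, β] := by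
    funext i; fin_cases i <;> simp
  rw [e] at h
  exact h

theorem wedge_add_right (α β β' : Ω[A⁄R]) : wedge α (β + β') = wedge α β + wedge α β' := by
  rw [wedge_swap, wedge_add_left, neg_add, ← wedge_swap, ← wedge_swap]

theorem wedge_smul_right (a : A) (α β : Ω[A⁄R]) : wedge α (a • β) = a • wedge α β := by
  rw [wedge_swap, wedge_smul_left, wedge_swap α β, smul_neg]

/-- The linear map `a ↦ da ∧ db`. -/
def dWedge (b : A) : A →ₗ[R] TwoForms R A where
  toFun a := wedge (D R A a) (D R A b)
  map_add' x y := by rw [map_add, wedge_add_left]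
  map_smul' r x := by
    rw [Derivation.map_smul, ← algebraMap_smul A r (D R A x), wedge_smul_left, algebraMap_smul,
      RingHom.id_apply]

/-- The map `∑ aⱼ [bⱼ] ↦ ∑ daⱼ ∧ dbⱼ` on the free module that presents `Ω¹_{A/R}`. -/
def extDerivFree : (A →₀ A) →ₗ[R] TwoForms R A :=
  Finsupp.lsum R (fun b : A => dWedge b)

theorem extDerivFree_single (a b : A) :
    extDerivFree (R := R) (Finsupp.single b a) = wedge (D R A a) (D R A b) := by
  rw [extDerivFree, Finsupp.lsum_single]
  rfl

theorem extDerivFree_smul (a : A) (v : A →₀ A) :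
    extDerivFree (R := R) (a • v) =
      wedge (D R A a) (Finsupp.linearCombination A (D R A) v) + a • extDerivFree (R := R) v := by
  induction v using Finsupp.induction_linear with
  | zero =>
    have h := wedge_smul_right (R := R) (0 : A) (D R A a) 0
    simp only [zero_smul] at h
    simp [h]
  | add f g hf hg =>
    rw [smul_add, map_add, hf, hg, map_add, map_add, wedge_add_right, smul_add]
    abel
  | single b c =>
    rw [Finsupp.smul_single, extDerivFree_single, extDerivFree_single,
      Finsupp.linearCombination_single, wedge_smul_right, smul_eq_mul, Derivation.leibniz,
      wedge_add_left, wedge_smul_left, wedge_smul_left]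
    abel

theorem extDerivFree_kerTotal (v : A →₀ A) (hv : v ∈ kerTotal R A) :
    extDerivFree (R := R) v = 0 := by
  rw [kerTotal] at hv
  induction hv using Submodule.span_induction with
  | zero => simp
  | add x y _ _ hx hy => rw [map_add, hx, hy, add_zero]
  | smul a x hx h =>
    have hx' : Finsupp.linearCombination A (D R A) x = 0 := by
      rw [← LinearMap.mem_ker, kerTotal_eq]
      exact hx
    have h0 := wedge_smul_right (R := R) (0 : A) (D R A a) 0
    simp only [zero_smul] at h0
    rw [extDerivFree_smul, h, hx', h0, smul_zero, add_zero]
  | mem x hx =>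
    have h0 : ∀ β : Ω[A⁄R], wedge 0 β = 0 := fun β => by
      have h0 := wedge_smul_left (R := R) (0 : A) 0 β
      simpa only [zero_smul] using h0
    rcases hx with ((⟨⟨x, y⟩, rfl⟩ | ⟨⟨x, y⟩, rfl⟩) | ⟨x, rfl⟩)
    · simp [extDerivFree_single, h0]
    · simp only [map_sub, map_add, extDerivFree_single, Derivation.map_one_eq_zero, h0, sub_zero]
      rw [wedge_swap (D R A x), neg_add_cancel]
    · simp [extDerivFree_single, h0]

/-- The exterior derivative `d : Ω¹_{A/R} → Ω²_{A/R}`, `∑ aⱼ dbⱼ ↦ ∑ daⱼ ∧ dbⱼ`. -/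
def extDeriv : Ω[A⁄R] →ₗ[R] TwoForms R A :=
  ((((kerTotal R A).restrictScalars R).liftQ extDerivFree
      (fun v hv => extDerivFree_kerTotal v hv)).comp
    (Submodule.Quotient.restrictScalarsEquiv R (kerTotal R A)).symm.toLinearMap).comp
    ((quotKerTotalEquiv R A).symm.toLinearMap.restrictScalars R)

/-- The formula `d(a db) = da ∧ db`, which determines `d`. -/
theorem extDeriv_smul_D (a b : A) :
    extDeriv (a • D R A b) = wedge (D R A a) (D R A b) := by
  have h : (quotKerTotalEquiv R A).symm (a • D R A b) =
      Submodule.Quotient.mk (Finsupp.single b a) := by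
    rw [LinearEquiv.symm_apply_eq]
    change _ = Finsupp.linearCombination A (D R A) (Finsupp.single b a)
    rw [Finsupp.linearCombination_single]
  have h' : (extDeriv (a • D R A b) : TwoForms R A) = ((kerTotal R A).restrictScalars R).liftQ
      extDerivFree (fun v hv => extDerivFree_kerTotal v hv)
        ((Submodule.Quotient.restrictScalarsEquiv R (kerTotal R A)).symm
          ((quotKerTotalEquiv R A).symm (a • D R A b))) := rfl
  rw [h', h]
  exact extDerivFree_single a b

end ExteriorDerivative

section ProjectiveSpace

variable (k : Type u) [Field k] (n : ℕ)

/-- The homogeneous coordinate ring `k[x₀, …, xₙ]` of `ℙⁿ`. -/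
abbrev CoordRing : Type u := MvPolynomial (Fin (n + 1)) k

/-- The field `k(x₀, …, xₙ)` of rational functions in the homogeneous coordinates. -/
abbrev RatFun : Type u := FractionRing (CoordRing k n)

/-- The function field of `ℙⁿ` as a subfield of `k(x₀, …, xₙ)`: quotients of homogeneous
polynomials of the same degree. -/
def degreeZeroSubfield : IntermediateField k (RatFun k n) where
  carrier := {z | ∃ (d : ℕ) (f g : CoordRing k n), f.IsHomogeneous d ∧ g.IsHomogeneous d ∧
    g ≠ 0 ∧ z = algebraMap _ (RatFun k n) f / algebraMap _ (RatFun k n) g}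
  mul_mem' := by
    rintro _ _ ⟨d, f, g, hf, hg, h0, rfl⟩ ⟨d', f', g', hf', hg', h0', rfl⟩
    exact ⟨d + d', f * f', g * g', hf.mul hf', hg.mul hg', mul_ne_zero h0 h0', by
      rw [map_mul, map_mul, div_mul_div_comm]⟩
  add_mem' := by
    rintro _ _ ⟨d, f, g, hf, hg, h0, rfl⟩ ⟨d', f', g', hf', hg', h0', rfl⟩
    refine ⟨d + d', f * g' + g * f', g * g', (hf.mul hg').add (hg.mul hf'), hg.mul hg',
      mul_ne_zero h0 h0', ?_⟩
    have i0 := (map_ne_zero_iff _ (IsFractionRing.injective (CoordRing k n) (RatFun k n))).2 h0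
    have i0' := (map_ne_zero_iff _ (IsFractionRing.injective (CoordRing k n) (RatFun k n))).2 h0'
    rw [div_add_div _ _ i0 i0', map_add, map_mul, map_mul, map_mul]
  algebraMap_mem' c := ⟨0, MvPolynomial.C c, 1, MvPolynomial.isHomogeneous_C _ _,
    MvPolynomial.isHomogeneous_one _ _, one_ne_zero, by
      rw [map_one, div_one, IsScalarTower.algebraMap_apply k (CoordRing k n) (RatFun k n)]
      rfl⟩
  inv_mem' := by
    rintro _ ⟨d, f, g, hf, hg, h0, rfl⟩
    by_cases hf0 : f = 0
    · exact ⟨0, 0, 1, MvPolynomial.isHomogeneous_zero _ _ _, MvPolynomial.isHomogeneous_one _ _,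
        one_ne_zero, by simp [hf0]⟩
    · exact ⟨d, g, f, hg, hf, hf0, by rw [inv_div]⟩

/-- The function field `k(ℙⁿ)`. -/
def FunctionField : Type u := degreeZeroSubfield k n

instance : Field (FunctionField k n) := inferInstanceAs (Field (degreeZeroSubfield k n))

instance : Algebra k (FunctionField k n) := inferInstanceAs (Algebra k (degreeZeroSubfield k n))

instance : Algebra (FunctionField k n) (RatFun k n) :=
  inferInstanceAs (Algebra (degreeZeroSubfield k n) (RatFun k n))

instance : IsScalarTower k (FunctionField k n) (RatFun k n) :=
  inferInstanceAs (IsScalarTower k (degreeZeroSubfield k n) (RatFun k n))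

variable {k n}

/-- The local ring `𝒪_{ℙⁿ, x}` at the closed point with homogeneous coordinates `x`:
the quotients `f / g` of homogeneous polynomials of the same degree with `g(x) ≠ 0`. -/
def localRing (x : Fin (n + 1) → k) : Subalgebra k (FunctionField k n) where
  carrier := {z | ∃ (d : ℕ) (f g : CoordRing k n), f.IsHomogeneous d ∧ g.IsHomogeneous d ∧
    MvPolynomial.eval x g ≠ 0 ∧
    algebraMap (FunctionField k n) (RatFun k n) z =
      algebraMap _ (RatFun k n) f / algebraMap _ (RatFun k n) g}
  mul_mem' := by
    rintro a b ⟨d, f, g, hf, hg, h0, e⟩ ⟨d', f', g', hf', hg', h0', e'⟩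
    exact ⟨d + d', f * f', g * g', hf.mul hf', hg.mul hg', by
      rw [map_mul]; exact mul_ne_zero h0 h0', by
      rw [map_mul, e, e', map_mul, map_mul, div_mul_div_comm]⟩
  add_mem' := by
    rintro a b ⟨d, f, g, hf, hg, h0, e⟩ ⟨d', f', g', hf', hg', h0', e'⟩
    refine ⟨d + d', f * g' + g * f', g * g', (hf.mul hg').add (hg.mul hf'), hg.mul hg', by
      rw [map_mul]; exact mul_ne_zero h0 h0', ?_⟩
    have j0 : g ≠ 0 := by rintro rfl; simp at h0
    have j0' : g' ≠ 0 := by rintro rfl; simp at h0'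
    have i0 := (map_ne_zero_iff _ (IsFractionRing.injective (CoordRing k n) (RatFun k n))).2 j0
    have i0' := (map_ne_zero_iff _ (IsFractionRing.injective (CoordRing k n) (RatFun k n))).2 j0'
    rw [map_add, e, e', div_add_div _ _ i0 i0', map_add, map_mul, map_mul, map_mul]
  algebraMap_mem' c := ⟨0, MvPolynomial.C c, 1, MvPolynomial.isHomogeneous_C _ _,
    MvPolynomial.isHomogeneous_one _ _, by simp, by
      rw [map_one, div_one]
      rw [← IsScalarTower.algebraMap_apply k (FunctionField k n) (RatFun k n),
        IsScalarTower.algebraMap_apply k (CoordRing k n) (RatFun k n)]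
      rfl⟩

/-- `a` is a local equation at `x` of the divisor with homogeneous equation `F = 0`: up to a unit
of `𝒪_{ℙⁿ, x}` it is `F / q`, where `q` is homogeneous of degree `deg F` and `q(x) ≠ 0`. -/
def IsLocalEquation (F : CoordRing k n) (x : Fin (n + 1) → k) (a : localRing x) : Prop :=
  ∃ (d : ℕ) (q : CoordRing k n) (v : (localRing x)ˣ), F.IsHomogeneous d ∧ q.IsHomogeneous d ∧
    MvPolynomial.eval x q ≠ 0 ∧
    algebraMap (FunctionField k n) (RatFun k n) a =
      algebraMap (FunctionField k n) (RatFun k n) (v : localRing x) *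
        (algebraMap _ (RatFun k n) F / algebraMap _ (RatFun k n) q)

variable (k n) in
/-- Rational 1-forms on `ℙⁿ`. -/
abbrev RatForm : Type u := Ω[FunctionField k n⁄k]

/-- The germs at `x` of regular 1-forms, inside the rational 1-forms: the `𝒪_{ℙⁿ, x}`-span of
the `db` with `b ∈ 𝒪_{ℙⁿ, x}`. -/
def regularOneForms (x : Fin (n + 1) → k) : Submodule (localRing x) (RatForm k n) :=
  Submodule.span (localRing x)
    {α | ∃ b : localRing x, α = D k (FunctionField k n) b}

/-- The germs at `x` of regular 2-forms, inside the rational 2-forms: the `𝒪_{ℙⁿ, x}`-span of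
the `db ∧ dc` with `b, c ∈ 𝒪_{ℙⁿ, x}`. -/
def regularTwoForms (x : Fin (n + 1) → k) :
    Submodule (localRing x) (TwoForms k (FunctionField k n)) :=
  Submodule.span (localRing x)
    {θ | ∃ b c : localRing x, θ = wedge (D k (FunctionField k n) b)
      (D k (FunctionField k n) c)}

/-- The rational 1-form `ω` is a global section of `Ω¹_{ℙⁿ}(log D)`, `D` the divisor `F = 0`:
at every closed point, for a local equation `a` of `D`, both `a ω` and `a dω` are regular. -/
def IsLogForm (F : CoordRing k n) (ω : RatForm k n) : Prop :=
  ∀ x : Fin (n + 1) → k, x ≠ 0 → ∃ a : localRing x, IsLocalEquation F x a ∧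
    (a : FunctionField k n) • ω ∈ regularOneForms x ∧
    (a : FunctionField k n) • extDeriv ω ∈ regularTwoForms x

/-- The divisor `F = 0` is normal crossing at the closed point `x`: there are an étale
`𝒪_{ℙⁿ, x}`-algebra `B` and a prime `q` of `B` over the closed point such that, in `B_q`, a local
equation of the divisor is, up to a unit, the product of a subset of a regular system of parameters
`z₁, …, zₙ` (`B_q` is regular of dimension `n`, so a regular system of parameters is the same as
`n` generators of the maximal ideal). The empty subset means that `x` is not on the divisor. -/
def IsNormalCrossingAt (F : CoordRing k n) (x : Fin (n + 1) → k) : Prop :=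
  ∃ a : localRing x, IsLocalEquation F x a ∧
    ∃ (B : Type u) (_ : CommRing B) (_ : Algebra (localRing x) B)
      (_ : Algebra.Etale (localRing x) B) (q : Ideal B) (_ : q.IsPrime),
      (∀ b : localRing x, algebraMap (localRing x) B b ∈ q ↔ ¬ IsUnit b) ∧
      ∃ z : Fin n → Localization.AtPrime q,
        Ideal.span (Set.range z) = IsLocalRing.maximalIdeal (Localization.AtPrime q) ∧
        ∃ J : Finset (Fin n),
          Associated (algebraMap B (Localization.AtPrime q) (algebraMap (localRing x) B a))
            (∏ j ∈ J, z j)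

/-- The closed subset of `ℙⁿ` where the homogeneous polynomials in `T` vanish has codimension at
least `c`: every homogeneous prime that contains `T` and is a point of `ℙⁿ`, that is, does not
contain all the coordinates, has height at least `c`. -/
def CodimAtLeast (T : Set (CoordRing k n)) (c : ℕ∞) : Prop :=
  ∀ P : Ideal (CoordRing k n), P.IsPrime →
    (∀ f ∈ P, ∀ d : ℕ, MvPolynomial.homogeneousComponent d f ∈ P) →
    T ⊆ P → (∃ i, MvPolynomial.X i ∉ P) → c ≤ P.height

/-- The divisor `F = 0` is normal crossing in codimension two: it is a normal crossing divisor
outside a closed subset of `ℙⁿ` of codimension at least three. -/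
def IsNormalCrossingInCodimTwo (F : CoordRing k n) : Prop :=
  ∃ T : Set (CoordRing k n), (∀ f ∈ T, ∃ d : ℕ, f.IsHomogeneous d) ∧ CodimAtLeast T 3 ∧
    ∀ x : Fin (n + 1) → k, x ≠ 0 → (∃ f ∈ T, MvPolynomial.eval x f ≠ 0) →
      IsNormalCrossingAt F x

variable (k n) in
/-- Expressing a rational 1-form on `ℙⁿ` in homogeneous coordinates: pull-back to rational
1-forms in `x₀, …, xₙ`. -/
def inHomogeneousCoords : RatForm k n →ₗ[FunctionField k n] Ω[RatFun k n⁄k] :=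
  KaehlerDifferential.map k k (FunctionField k n) (RatFun k n)

/-- The rational 1-form `dh / h` in the homogeneous coordinates. -/
def dlog (h : CoordRing k n) : Ω[RatFun k n⁄k] :=
  (algebraMap (CoordRing k n) (RatFun k n) h)⁻¹ •
    D k (RatFun k n) (algebraMap (CoordRing k n) (RatFun k n) h)

end ProjectiveSpace

end

end LogForms

/-! Let F be the product of the h_i. Since Fω is regular at every point, ω = ∑ (A_j / F) dx_j with
polynomials A_j, and ∑ x_j A_j = 0 because ω comes from projective space. Everything is about the
residue of ω along one component h = 0, where F = hG.

Regularity of F dω gives that h divides A_l ∂_j F - A_j ∂_l F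
(`dvd_mul_pderiv_sub_of_eval_eq_zero`). So modulo h the vector (A_j) is ρ times (G ∂_j h), where ρ =
A_{j₀} / (G ∂_{j₀} h) is a homogeneous fraction of degree 0 on the cone over h = 0. Some ∂_{j₀} h is
nonzero because k is perfect. The point is that the residue ρ is a constant.

The hypersurface need not be normal, so one shows that ρ is integral over k[x]/(h), not that it is
regular. Near a normal crossing point, after an étale extension, h = 0 splits into smooth branches
z_j = 0, and on each of them ρ is the restriction of a regular function a_j
(`exists_dvd_prod_sub_mul`). Hence ∏ (ρ - a_j) vanishes on h = 0. This is an integral equation for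
ρ, written as an ideal membership, which descends along the faithfully flat extension
(`exists_pow_mem_integralRelationIdeal_of_formallyEtale`). The bad set has codimension at least 3 in
projective space, so ρ is integral at all primes of codimension one of k[x]/(h), and therefore
integral (`isIntegral_of_forall_minimalPrimes_span_singleton`). As ρ has degree 0, the part of an
integral equation of the right degree is an equation over k, so ρ = α lies in k
(`exists_dvd_sub_C_mul_of_isIntegral`). On the projective line the components are points, and α is a
quotient of values.

With α_i the residue along h_i, the polynomial A_j - ∑ α_i (F / h_i) ∂_j h_i is divisible by every
h_i, hence by F. Its degree is deg F - 1, so it is zero. The relation ∑ x_j A_j = 0 and Euler's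
identity give ∑ α_i deg h_i = 0. -/

/-! ### Regular local rings: domains, and parameters are primes. -/

open IsLocalRing in
/-- A Noetherian local ring whose maximal ideal has as few generators as its dimension allows is a
domain. -/
theorem IsLocalRing.isDomain_of_span_eq_maximalIdeal (d : ℕ) :
    ∀ (R : Type*) [CommRing R] [IsLocalRing R] [IsNoetherianRing R] (z : Fin d → R),
      Ideal.span (Set.range z) = maximalIdeal R → (d : WithBot ℕ∞) ≤ ringKrullDim R →
      IsDomain R := by
  induction d with
  | zero =>
    intro R _ _ _ z hz _
    have h : maximalIdeal R = ⊥ := by rw [← hz]; simp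
    exact (isField_iff_maximalIdeal_eq.2 h).isDomain
  | succ d ih =>
    intro R _ _ _ z hz hd
    have hfin := minimalPrimes.finite_of_isNoetherianRing R
    have hnot : ∀ p ∈ minimalPrimes R, ¬ maximalIdeal R ≤ p := by
      intro p hp hle
      have hpp : p.IsPrime := hp.1.1
      have hpm : maximalIdeal R = p := le_antisymm hle (le_maximalIdeal hpp.ne_top)
      have h0 : (maximalIdeal R).height = 0 := by
        have h1 := Ideal.height_le_card_of_mem_minimalPrimes_span (R := R) (p := p)
          Set.finite_empty (by rw [Ideal.span_empty]; exact hp)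
        rw [hpm]
        simpa using h1
      rw [← maximalIdeal_height_eq_ringKrullDim, h0] at hd
      norm_cast at hd
    have hsq : ¬ maximalIdeal R ≤ maximalIdeal R ^ 2 := by
      intro hle
      have h0 : maximalIdeal R = ⊥ := by
        apply Submodule.eq_bot_of_le_smul_of_le_jacobson_bot (maximalIdeal R) (maximalIdeal R)
          (IsNoetherian.noetherian _)
        · rwa [smul_eq_mul, ← pow_two]
        · exact maximalIdeal_le_jacobson _
      obtain ⟨p, hp⟩ := Ideal.nonempty_minimalPrimes (I := (⊥ : Ideal R)) bot_ne_top
      exact hnot p hp (by rw [h0]; exact bot_le)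
    -- Prime avoidance. The square of the maximal ideal is not prime, but one such ideal is allowed
    -- in the union.
    obtain ⟨x, hxm, hx⟩ : ∃ x ∈ maximalIdeal R, x ∉ maximalIdeal R ^ 2 ∧
        ∀ p ∈ minimalPrimes R, x ∉ p := by
      by_contra! hcon
      have hsub : (maximalIdeal R : Set R) ⊆
          ⋃ I ∈ ((insert (maximalIdeal R ^ 2) hfin.toFinset : Finset (Ideal R)) : Set (Ideal R)),
            (I : Set R) := by
        intro x hx
        by_cases h2 : x ∈ maximalIdeal R ^ 2
        · exact Set.mem_biUnion (by simp) h2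
        · obtain ⟨p, hp, hxp⟩ := hcon x hx h2
          exact Set.mem_biUnion (by simp [hp]) hxp
      obtain ⟨I, hI, hle⟩ := (Ideal.subset_union_prime (f := id) (maximalIdeal R ^ 2)
        (maximalIdeal R ^ 2) (fun I hI h1 _ => by
          rcases Finset.mem_insert.1 hI with h | h
          · exact absurd h h1
          · exact ((hfin.mem_toFinset).1 h).1.1)).1 hsub
      rcases Finset.mem_insert.1 hI with h | h
      · exact hsq (h ▸ hle)
      · exact hnot I ((hfin.mem_toFinset).1 h) hle
    obtain ⟨hx2, hxp⟩ := hx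
    obtain ⟨a, ha⟩ : ∃ a : Fin (d + 1) → R, ∑ i, a i • z i = x := by
      rw [← hz] at hxm
      exact (Submodule.mem_span_range_iff_exists_fun R).1 hxm
    have hzm : ∀ i, z i ∈ maximalIdeal R := fun i => hz ▸ Ideal.subset_span ⟨i, rfl⟩
    -- Since x is not in the square of the maximal ideal, it can replace some generator z i, so the
    -- other d generators suffice modulo x and induction applies to the quotient.
    obtain ⟨i, hi⟩ : ∃ i, IsUnit (a i) := by
      by_contra! hcon
      apply hx2
      rw [← ha, pow_two]
      exact Ideal.sum_mem _ fun i _ =>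
        Ideal.mul_mem_mul ((mem_maximalIdeal _).2 (hcon i)) (hzm i)
    have : Nontrivial (R ⧸ Ideal.span {x}) := Ideal.Quotient.nontrivial_iff.2 (by
      intro h
      rw [Ideal.span_singleton_eq_top] at h
      exact (mem_maximalIdeal _).1 hxm h)
    have : IsLocalRing (R ⧸ Ideal.span {x}) :=
      .of_surjective' _ Ideal.Quotient.mk_surjective
    have hdom : IsDomain (R ⧸ Ideal.span {x}) := by
      apply ih _ (fun j => Ideal.Quotient.mk _ (z (i.succAbove j)))
      · rw [← IsLocalRing.map_maximalIdeal_of_surjective (Ideal.Quotient.mk (Ideal.span {x}))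
          Ideal.Quotient.mk_surjective, ← hz, Ideal.map_span]
        apply le_antisymm
        · apply Ideal.span_mono
          rintro _ ⟨j, rfl⟩
          exact ⟨_, ⟨_, rfl⟩, rfl⟩
        · rw [Ideal.span_le]
          rintro _ ⟨_, ⟨j, rfl⟩, rfl⟩
          rcases eq_or_ne j i with rfl | hj
          · have h0 : Ideal.Quotient.mk (Ideal.span {x}) x = 0 :=
              Ideal.Quotient.eq_zero_iff_mem.2 (Ideal.mem_span_singleton_self x)
            obtain ⟨u, hu⟩ := hi
            have ha' := congrArg (Ideal.Quotient.mk (Ideal.span {x})) ha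
            rw [h0, Fin.sum_univ_succAbove _ j, map_add, map_sum] at ha'
            have h1 : Ideal.Quotient.mk (Ideal.span {x}) (z j) =
                Ideal.Quotient.mk (Ideal.span {x}) (↑u⁻¹ : R) *
                  (- ∑ l, Ideal.Quotient.mk (Ideal.span {x})
                    (a (j.succAbove l) • z (j.succAbove l))) := by
              rw [← eq_neg_of_add_eq_zero_left ha', ← map_mul, ← hu, smul_eq_mul, Units.inv_mul_cancel_left]
            rw [SetLike.mem_coe, h1]
            refine Ideal.mul_mem_left _ _ (neg_mem (Ideal.sum_mem _ fun l _ => ?_))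
            rw [smul_eq_mul, map_mul]
            exact Ideal.mul_mem_left _ _ (Ideal.subset_span ⟨l, rfl⟩)
          · obtain ⟨l, rfl⟩ := Fin.exists_succAbove_eq hj
            exact Ideal.subset_span ⟨l, rfl⟩
      · have h1 := ringKrullDim_le_ringKrullDim_quotient_add_card (R := R) {x}
          (by simpa [ringJacobson_eq_maximalIdeal] using hxm)
        rw [Finset.coe_singleton, Finset.card_singleton] at h1
        have h2 := hd.trans h1
        push_cast at h2
        exact (ENat.WithBot.add_le_add_one_right_iff).1 h2
    have hprime : (Ideal.span {x}).IsPrime := (Ideal.Quotient.isDomain_iff_prime _).1 hdom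
    -- A minimal prime p inside the prime (x) does not contain x, so p = xp, and p = 0 by Nakayama.
    obtain ⟨p, hp, hple⟩ := Ideal.exists_minimalPrimes_le (I := (⊥ : Ideal R)) (J := Ideal.span {x})
      bot_le
    have hpp : p.IsPrime := hp.1.1
    have hp0 : p = ⊥ := by
      apply Submodule.eq_bot_of_le_smul_of_le_jacobson_bot (Ideal.span {x}) p
        (IsNoetherian.noetherian _)
      · intro y hy
        obtain ⟨b, rfl⟩ := Ideal.mem_span_singleton'.1 (hple hy)
        have hb : b ∈ p := (hpp.mem_or_mem hy).resolve_right (hxp p hp)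
        rw [mul_comm]
        exact Ideal.mul_mem_mul (Ideal.mem_span_singleton_self x) hb
      · exact (le_maximalIdeal hprime.ne_top).trans (maximalIdeal_le_jacobson _)
    rw [hp0] at hpp
    exact IsDomain.of_bot_isPrime R

namespace IsLocalRing

variable {R : Type*} [CommRing R] [IsLocalRing R] [IsNoetherianRing R] {n : ℕ} {z : Fin n → R}

/-- Krull's height theorem: n - 1 elements cannot generate a maximal ideal of height at least n. -/
theorem not_subset_span_erase_of_le_ringKrullDim
    (hz : Ideal.span (Set.range z) = maximalIdeal R) (hn : (n : WithBot ℕ∞) ≤ ringKrullDim R)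
    (j : Fin n) : z j ∉ Ideal.span (z '' {j}ᶜ) := by
  intro hj
  have h1 : Ideal.span (z '' {j}ᶜ) = maximalIdeal R := by
    rw [← hz]
    apply le_antisymm (Ideal.span_mono (Set.image_subset_range _ _))
    rw [Ideal.span_le]
    rintro _ ⟨i, rfl⟩
    rcases eq_or_ne i j with rfl | hij
    · exact hj
    · exact Ideal.subset_span ⟨i, hij, rfl⟩
  have h2 : (maximalIdeal R).height ≤ (z '' {j}ᶜ).ncard := by
    apply Ideal.height_le_card_of_mem_minimalPrimes_span (Set.toFinite _)
    rw [h1, Ideal.minimalPrimes_eq_subsingleton_self]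
    rfl
  have h3 : (z '' ({j}ᶜ : Set (Fin n))).ncard ≤ n - 1 := by
    refine (Set.ncard_image_le).trans ?_
    rw [Set.ncard_compl, Set.ncard_singleton, Nat.card_eq_fintype_card, Fintype.card_fin]
  rw [← maximalIdeal_height_eq_ringKrullDim] at hn
  have h4 : (n : ℕ∞) ≤ (maximalIdeal R).height := by exact_mod_cast hn
  have h5 : (n : ℕ∞) ≤ ((n - 1 : ℕ) : ℕ∞) := h4.trans (h2.trans (by exact_mod_cast h3))
  have h6 : n ≤ n - 1 := by exact_mod_cast h5
  have := j.pos
  omega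

theorem not_dvd_of_le_ringKrullDim
    (hz : Ideal.span (Set.range z) = maximalIdeal R) (hn : (n : WithBot ℕ∞) ≤ ringKrullDim R)
    {i j : Fin n} (hij : i ≠ j) : ¬ z i ∣ z j := fun ⟨_, ha⟩ =>
  not_subset_span_erase_of_le_ringKrullDim hz hn j
    (ha ▸ Ideal.mul_mem_right _ _ (Ideal.subset_span ⟨i, hij, rfl⟩))

/-- Modulo z j the maximal ideal has n - 1 generators and the dimension drops by at most one, so the
quotient is again a domain. -/
theorem prime_of_le_ringKrullDim
    (hz : Ideal.span (Set.range z) = maximalIdeal R) (hn : (n : WithBot ℕ∞) ≤ ringKrullDim R)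
    (j : Fin n) : Prime (z j) := by
  have h0 : z j ≠ 0 := fun h =>
    not_subset_span_erase_of_le_ringKrullDim hz hn j (by rw [h]; exact zero_mem _)
  rw [← Ideal.span_singleton_prime h0, ← Ideal.Quotient.isDomain_iff_prime]
  have hjm : z j ∈ maximalIdeal R := hz ▸ Ideal.subset_span ⟨j, rfl⟩
  have : Nontrivial (R ⧸ Ideal.span {z j}) := Ideal.Quotient.nontrivial_iff.2 (by
    intro h
    rw [Ideal.span_singleton_eq_top] at h
    exact (mem_maximalIdeal _).1 hjm h)
  have : IsLocalRing (R ⧸ Ideal.span {z j}) := .of_surjective' _ Ideal.Quotient.mk_surjective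
  obtain _ | d := n
  · exact j.elim0
  apply isDomain_of_span_eq_maximalIdeal d _ (fun l => Ideal.Quotient.mk _ (z (j.succAbove l)))
  · rw [← IsLocalRing.map_maximalIdeal_of_surjective (Ideal.Quotient.mk (Ideal.span {z j}))
      Ideal.Quotient.mk_surjective, ← hz, Ideal.map_span]
    apply le_antisymm
    · apply Ideal.span_mono
      rintro _ ⟨l, rfl⟩
      exact ⟨_, ⟨_, rfl⟩, rfl⟩
    · rw [Ideal.span_le]
      rintro _ ⟨_, ⟨i, rfl⟩, rfl⟩
      rcases eq_or_ne i j with rfl | hj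
      · rw [Ideal.Quotient.eq_zero_iff_mem.2 (Ideal.mem_span_singleton_self _)]
        exact zero_mem _
      · obtain ⟨l, rfl⟩ := Fin.exists_succAbove_eq hj
        exact Ideal.subset_span ⟨l, rfl⟩
  · have h1 := ringKrullDim_le_ringKrullDim_quotient_add_card (R := R) {z j}
      (by simpa [ringJacobson_eq_maximalIdeal] using hjm)
    rw [Finset.coe_singleton, Finset.card_singleton] at h1
    have h2 := hn.trans h1
    push_cast at h2
    exact (ENat.WithBot.add_le_add_one_right_iff).1 h2

end IsLocalRing

/-! ### Integrality over a factorial ring, and integrality in codimension one. -/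

section

open Polynomial

variable {P K : Type*} (F : Type*) [CommRing P] [Field F] [Algebra P F]
  [IsFractionRing P F] [Field K] [Algebra P K] [Algebra F K] [IsScalarTower P F K] {y : K} {s : P}

theorem IsIntegral.of_smul_of_isFractionRing (hs : s ≠ 0) (hsy : IsIntegral P (s • y)) :
    IsIntegral F y := by
  have h1 : IsIntegral F (s • y) := hsy.tower_top
  have hs' : algebraMap P F s ≠ 0 := (map_ne_zero_iff _ (IsFractionRing.injective P F)).2 hs
  have h2 : y = (algebraMap P F s)⁻¹ • (s • y) := by
    rw [← algebraMap_smul F s y, smul_smul, inv_mul_cancel₀ hs', one_smul]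
  rw [h2]
  exact h1.smul _

theorem minpoly_smul_eq_scaleRoots {F K : Type*} [Field F] [Field K] [Algebra F K] {y : K} {s : F}
    (hs : s ≠ 0) (hy : IsIntegral F y) : minpoly F (s • y) = (minpoly F y).scaleRoots s := by
  have hsy : IsIntegral F (s • y) := hy.smul s
  symm
  refine Polynomial.eq_of_monic_of_dvd_of_natDegree_le (minpoly.monic hsy)
    ((monic_scaleRoots_iff _).2 (minpoly.monic hy)) (minpoly.dvd _ _ ?_) ?_
  · rw [Algebra.smul_def]
    exact scaleRoots_aeval_eq_zero (minpoly.aeval F y)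
  · rw [natDegree_scaleRoots]
    have h3 : aeval y ((minpoly F (s • y)).scaleRoots s⁻¹) = 0 := by
      have h4 := scaleRoots_aeval_eq_zero (r := s⁻¹) (minpoly.aeval F (s • y))
      rwa [← Algebra.smul_def, smul_smul, inv_mul_cancel₀ hs, one_smul] at h4
    rw [← natDegree_scaleRoots (minpoly F (s • y)) s⁻¹]
    exact natDegree_le_of_dvd (minpoly.dvd _ _ h3)
      ((monic_scaleRoots_iff _).2 (minpoly.monic hsy)).ne_zero

/-- The right-hand side is a coefficient of the minimal polynomial of s • y, which has coefficients
in P because P is integrally closed. -/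
theorem exists_algebraMap_eq_coeff_minpoly_mul_pow [IsDomain P] [IsIntegrallyClosed P]
    (hs : s ≠ 0)
    (hsy : IsIntegral P (s • y)) (i : ℕ) :
    ∃ b, algebraMap P F b =
      (minpoly F y).coeff i * algebraMap P F s ^ ((minpoly F y).natDegree - i) := by
  have hs' : algebraMap P F s ≠ 0 := (map_ne_zero_iff _ (IsFractionRing.injective P F)).2 hs
  have hyF := IsIntegral.of_smul_of_isFractionRing F hs hsy
  refine ⟨(minpoly P (s • y)).coeff i, ?_⟩
  rw [← coeff_scaleRoots, ← minpoly_smul_eq_scaleRoots hs' hyF, algebraMap_smul,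
    minpoly.isIntegrallyClosed_eq_field_fractions' F hsy, coeff_map]

/-- A prime q in the denominator of a coefficient would divide a power of s for every s with s • y
integral, against the choice of an s prime to q. -/
theorem minpoly_mem_lifts_of_forall_prime_exists_smul [IsDomain P] [UniqueFactorizationMonoid P]
    (h : ∀ q : P, Prime q → ∃ s : P, ¬ q ∣ s ∧ IsIntegral P (s • y)) :
    minpoly F y ∈ lifts (algebraMap P F) := by
  have hinj : Function.Injective (algebraMap P F) := IsFractionRing.injective P F
  rw [lifts_iff_coeff_lifts]
  intro i
  set c := (minpoly F y).coeff i
  have hden : IsUnit (IsFractionRing.den P c : P) := by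
    by_contra hnu
    obtain ⟨q, hq, hqd⟩ := WfDvdMonoid.exists_irreducible_factor hnu
      (nonZeroDivisors.ne_zero (IsFractionRing.den P c).2)
    obtain ⟨s, hqs, hsy⟩ := h q hq.prime
    have hs0 : s ≠ 0 := by rintro rfl; exact hqs (dvd_zero _)
    obtain ⟨b, hb⟩ := exists_algebraMap_eq_coeff_minpoly_mul_pow F hs0 hsy i
    have h1 : b * (IsFractionRing.den P c : P) =
        IsFractionRing.num P c * s ^ ((minpoly F y).natDegree - i) := by
      apply hinj
      rw [map_mul, map_mul, map_pow, hb]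
      have h2 := IsFractionRing.mk'_num_den' P c
      rw [div_eq_iff ((map_ne_zero_iff _ hinj).2
        (nonZeroDivisors.ne_zero (IsFractionRing.den P c).2))] at h2
      rw [h2]
      ring
    have h3 : (IsFractionRing.den P c : P) ∣ s ^ ((minpoly F y).natDegree - i) :=
      (IsFractionRing.num_den_reduced P c).symm.dvd_of_dvd_mul_left ⟨b, by rw [← h1, mul_comm]⟩
    exact hqs (hq.prime.dvd_of_dvd_pow (hqd.trans h3))
  obtain ⟨u, hu⟩ := hden
  refine ⟨IsFractionRing.num P c * (↑u⁻¹ : P), ?_⟩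
  have h2 := IsFractionRing.mk'_num_den' P c
  rw [div_eq_iff ((map_ne_zero_iff _ hinj).2
    (nonZeroDivisors.ne_zero (IsFractionRing.den P c).2))] at h2
  rw [map_mul, h2, ← hu, mul_assoc, ← map_mul, Units.mul_inv, map_one, mul_one]

/-- The hypothesis `h0` makes y algebraic over the fraction field; `h` alone says nothing when P is
a field. -/
theorem isIntegral_of_forall_prime_exists_smul [IsDomain P] [UniqueFactorizationMonoid P]
    [FaithfulSMul P K]
    (h0 : ∃ s : P, s ≠ 0 ∧ IsIntegral P (s • y))
    (h : ∀ q : P, Prime q → ∃ s : P, ¬ q ∣ s ∧ IsIntegral P (s • y)) : IsIntegral P y := by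
  let := FractionRing.liftAlgebra P K
  obtain ⟨s, hs, hsy⟩ := h0
  have hyF := IsIntegral.of_smul_of_isFractionRing (FractionRing P) hs hsy
  obtain ⟨g, hg, -, hmon⟩ := lifts_and_natDegree_eq_and_monic
    (minpoly_mem_lifts_of_forall_prime_exists_smul (FractionRing P) h) (minpoly.monic hyF)
  refine ⟨g, hmon, ?_⟩
  rw [← aeval_def, ← aeval_map_algebraMap (FractionRing P), hg, minpoly.aeval]

end

/-- An element of the fraction field of a finitely generated domain that is integral in codimension
one is integral. -/
theorem isIntegral_of_forall_minimalPrimes_span_singleton (k : Type*) {R K : Type*} [Field k]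
    [CommRing R] [IsDomain R] [Algebra k R] [Algebra.FiniteType k R] [Field K] [Algebra R K]
    [IsFractionRing R K] {y : K}
    (h : ∀ r : R, r ≠ 0 → ∀ Q ∈ (Ideal.span {r}).minimalPrimes,
      ∃ u, u ∉ Q ∧ IsIntegral R (u • y)) : IsIntegral R y := by
  -- Noether normalization: R is integral over a polynomial ring P, which is factorial, so only the
  -- primes q of P have to be tested.
  obtain ⟨m, g, hg, hint⟩ := exists_integral_inj_algHom_of_fg k R
  let P := MvPolynomial (Fin m) k
  let : Algebra P R := g.toRingHom.toAlgebra
  let : Algebra P K := ((algebraMap R K).comp g.toRingHom).toAlgebra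
  have : IsScalarTower P R K := IsScalarTower.of_algebraMap_eq fun _ => rfl
  have hPR : Function.Injective (algebraMap P R) := hg
  have : FaithfulSMul P K := (faithfulSMul_iff_algebraMap_injective P K).2
    ((IsFractionRing.injective R K).comp hg)
  have : Algebra.IsIntegral P R := ⟨hint⟩
  have htrans : ∀ w : K, IsIntegral R w → IsIntegral P w := fun w hw => isIntegral_trans w hw
  let J : Ideal R := Submodule.comap (LinearMap.toSpanSingleton R K y)
    (Subalgebra.toSubmodule (integralClosure R K))
  have hJ : ∀ u, u ∈ J ↔ IsIntegral R (u • y) := fun u => Iff.rfl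
  have hsmul : ∀ s : P, algebraMap P R s ∈ J → IsIntegral P (s • y) := fun s hs =>
    htrans _ (by rwa [hJ, algebraMap_smul] at hs)
  have : IsIntegral P y := by
    apply isIntegral_of_forall_prime_exists_smul
    · obtain ⟨⟨a, b⟩, hab⟩ := IsLocalization.surj (nonZeroDivisors R) y
      have hbJ : (b : R) ∈ J := by
        rw [hJ, Algebra.smul_def, mul_comm, hab]
        exact isIntegral_algebraMap
      have hne : J ≠ ⊥ := fun h => nonZeroDivisors.ne_zero b.2 (by
        have := hbJ; rw [h] at this; exact this)
      obtain ⟨s, hs, hs0⟩ := Submodule.exists_mem_ne_zero_of_ne_bot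
        (Ideal.IsIntegral.comap_ne_bot P hne)
      exact ⟨s, hs0, hsmul s hs⟩
    · intro q hq
      by_contra! hcon
      have hqp : (Ideal.span {q}).IsPrime := (Ideal.span_singleton_prime hq.ne_zero).2 hq
      -- J is the ideal of all u with u • y integral. If its trace on P lay in (q), some prime Q ⊇ J
      -- would lie over (q). By incomparability Q is minimal over qR, and `h` gives an element of J
      -- outside Q.
      obtain ⟨Q, hJQ, hQ, hQq⟩ := Ideal.exists_ideal_over_prime_of_isIntegral (Ideal.span {q}) J
        (fun s hs => by
          rw [Ideal.mem_span_singleton]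
          by_contra hqs
          exact hcon s hqs (hsmul s hs))
      have hmin := Ideal.IsIntegral.mem_minimalPrimes_map_under (R := P) Q
      rw [Ideal.under_def, hQq, Ideal.map_span, Set.image_singleton] at hmin
      obtain ⟨u, huQ, hu⟩ := h _ ((map_ne_zero_iff _ hPR).2 hq.ne_zero) Q hmin
      exact huQ (hJQ ((hJ u).2 hu))
  exact this.tower_top

/-! ### The residue on the branches of a normal crossing divisor. -/

section NormalCrossing

variable {k C ι : Type*} [CommRing k] [CommRing C] [Algebra k C]

/-- The primes z j can be cancelled one at a time, which needs no unique factorization in C. -/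
theorem dvd_of_dvd_prod_mul_of_forall_not_dvd [IsDomain C] {s : Finset ι} {z : ι → C}
    (hz : ∀ j ∈ s, Prime (z j)) : ∀ {r w : C}, (∀ j ∈ s, ¬ z j ∣ r) → r ∣ (∏ j ∈ s, z j) * w →
      r ∣ w := by
  classical
  induction s using Finset.induction_on with
  | empty => intro r w _ h; simpa using h
  | insert i s hi ih =>
    intro r w hr h
    rw [Finset.prod_insert hi, mul_assoc] at h
    refine ih (fun j hj => hz j (Finset.mem_insert_of_mem hj))
      (fun j hj => hr j (Finset.mem_insert_of_mem hj)) ?_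
    obtain ⟨c, hc⟩ := h
    have hzi := hz i (Finset.mem_insert_self _ _)
    obtain ⟨c', rfl⟩ := (hzi.dvd_or_dvd (Dvd.intro _ hc)).resolve_left
      (hr i (Finset.mem_insert_self _ _))
    exact ⟨c', mul_left_cancel₀ hzi.ne_zero (by rw [hc]; ring)⟩

theorem prod_dvd_of_forall_prime_dvd {s : Finset ι} {z : ι → C} (hz : ∀ j ∈ s, Prime (z j))
    (hne : ∀ i ∈ s, ∀ j ∈ s, i ≠ j → ¬ z i ∣ z j) {w : C} (h : ∀ j ∈ s, z j ∣ w) :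
    ∏ j ∈ s, z j ∣ w := by
  classical
  induction s using Finset.induction_on with
  | empty => simp
  | insert i s hi ih =>
    rw [Finset.prod_insert hi]
    obtain ⟨c, rfl⟩ := ih (fun j hj => hz j (Finset.mem_insert_of_mem hj))
      (fun a ha b hb => hne a (Finset.mem_insert_of_mem ha) b (Finset.mem_insert_of_mem hb))
      (fun j hj => h j (Finset.mem_insert_of_mem hj))
    have hzi := hz i (Finset.mem_insert_self _ _)
    rcases hzi.dvd_or_dvd (h i (Finset.mem_insert_self _ _)) with h1 | h1
    · obtain ⟨j, hj, hij⟩ := (Prime.dvd_finsetProd_iff hzi _).1 h1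
      exact absurd hij (hne i (Finset.mem_insert_self _ _) j (Finset.mem_insert_of_mem hj)
        (by rintro rfl; exact hi hj))
    · rw [mul_comm]
      exact mul_dvd_mul_left _ h1

variable {J : Finset ι} {z : ι → C} {f : C}

/-- A divisor of a product of primes is associated to the product of those that divide it. -/
theorem dvd_prod_filter_dvd [IsDomain C] [DecidablePred fun j => z j ∣ f]
    (hz : ∀ j ∈ J, Prime (z j))
    (hf : f ∣ ∏ j ∈ J, z j) :
    f ∣ ∏ j ∈ J with z j ∣ f, z j := by
  rw [← Finset.prod_filter_mul_prod_filter_not J (fun j => z j ∣ f), mul_comm] at hf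
  exact dvd_of_dvd_prod_mul_of_forall_not_dvd
    (fun j hj => hz j (Finset.mem_filter.1 hj).1) (fun j hj => (Finset.mem_filter.1 hj).2) hf

variable [DecidableEq ι] {δ : ι → Derivation k C C}

/-- Here E j is the coefficient of fω on δ j, and `hE` says that f divides df ∧ fω. Write f = z i *
w. Modulo z i one has δ i f = w, prime to z i, and δ j f = 0, so w * E j vanishes. Thus ω has a pole
along z i = 0 only in the direction of dz i. -/
theorem dvd_coeff_of_dvd_derivation_mul_sub (hz : ∀ j ∈ J, Prime (z j))
    (hne : ∀ i ∈ J, ∀ j ∈ J, i ≠ j → ¬ z i ∣ z j)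
    (hδ : ∀ i j, δ i (z j) = if i = j then 1 else 0)
    (hf : Associated f (∏ j ∈ J, z j)) {E : ι → C}
    (hE : ∀ i j, f ∣ δ i f * E j - δ j f * E i) {i j : ι} (hi : i ∈ J) (hij : i ≠ j) :
    z i ∣ E j := by
  obtain ⟨u, hu⟩ := hf.symm
  set w := (∏ l ∈ J.erase i, z l) * u with hw
  have hfw : f = z i * w := by rw [← hu, ← Finset.mul_prod_erase J z hi, mul_assoc]
  have hzw : ¬ z i ∣ w := by
    intro h
    rcases (hz i hi).dvd_or_dvd h with h | h
    · obtain ⟨l, hl, hil⟩ := (Prime.dvd_finsetProd_iff (hz i hi) _).1 h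
      rw [Finset.mem_erase] at hl
      exact hne i hi l hl.2 (Ne.symm hl.1) hil
    · exact (hz i hi).not_isUnit (isUnit_of_dvd_unit h u.isUnit)
  have h1 : z i ∣ δ i f * E j - δ j f * E i := (Dvd.intro _ hfw.symm).trans (hE i j)
  have hi1 : δ i f = w + z i * δ i w := by
    rw [hfw, Derivation.leibniz, hδ, if_pos rfl, smul_eq_mul, smul_eq_mul]; ring
  have hj1 : δ j f = z i * δ j w := by
    rw [hfw, Derivation.leibniz, hδ, if_neg hij.symm, smul_eq_mul, smul_eq_mul]; ring
  have h2 : z i ∣ w * E j := by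
    have h3 : w * E j = (δ i f * E j - δ j f * E i) - z i * (δ i w * E j - δ j w * E i) := by
      rw [hi1, hj1]; ring
    rw [h3]
    exact dvd_sub h1 (dvd_mul_right _ _)
  exact ((hz i hi).dvd_or_dvd h2).resolve_left hzw

/-- Along a normal crossing divisor `f = t g`, the residue `P / Q` of a logarithmic form takes the
values `a j` on the branches of `t = 0`. -/
theorem exists_dvd_prod_sub_mul [IsDomain C] (hz : ∀ j ∈ J, Prime (z j))
    (hne : ∀ i ∈ J, ∀ j ∈ J, i ≠ j → ¬ z i ∣ z j)
    (hδ : ∀ i j, δ i (z j) = if i = j then 1 else 0)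
    {t g : C} (hf : Associated (t * g) (∏ j ∈ J, z j)) {E : ι → C}
    (hE : ∀ i j, t * g ∣ δ i (t * g) * E j - δ j (t * g) * E i)
    {P Q : C} (hPQ : ∀ j, t ∣ Q * E j - P * (g * δ j t)) :
    ∃ (s : Finset ι) (a : ι → C), t ∣ ∏ j ∈ s, (P - Q * a j) := by
  classical
  have key : ∀ j, ∃ a, j ∈ J.filter (fun j => z j ∣ t) → z j ∣ P - Q * a := by
    intro j
    by_cases hj : j ∈ J.filter (fun j => z j ∣ t)
    swap
    · exact ⟨0, fun h => absurd h hj⟩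
    obtain ⟨hjJ, t', ht'⟩ := Finset.mem_filter.1 hj
    have hzj := hz j hjJ
    obtain ⟨u, hu⟩ := hf
    have hprod : t' * g * u = ∏ l ∈ J.erase j, z l := by
      apply mul_left_cancel₀ hzj.ne_zero
      rw [Finset.mul_prod_erase J z hjJ, ← hu, ht']
      ring
    have hndvd : ¬ z j ∣ t' * g := by
      intro h
      obtain ⟨l, hl, hil⟩ := (Prime.dvd_finsetProd_iff hzj _).1 (hprod ▸ h.mul_right (u : C))
      rw [Finset.mem_erase] at hl
      exact hne j hjJ l hl.2 (Ne.symm hl.1) hil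
    -- By the previous lemma every other branch divides E j, and t' * g is their product up to a
    -- unit. The quotient a is the value of the residue on the branch z j = 0.
    have hEj : t' * g ∣ E j := by
      refine (Dvd.intro _ hprod).trans (prod_dvd_of_forall_prime_dvd
        (fun l hl => hz l (Finset.mem_of_mem_erase hl))
        (fun a ha b hb => hne a (Finset.mem_of_mem_erase ha) b (Finset.mem_of_mem_erase hb))
        fun l hl => ?_)
      exact dvd_coeff_of_dvd_derivation_mul_sub hz hne hδ ⟨u, hu⟩ hE (Finset.mem_of_mem_erase hl)
        (Finset.ne_of_mem_erase hl)
    obtain ⟨a, ha⟩ := hEj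
    refine ⟨a, fun _ => ?_⟩
    have h1 : z j ∣ Q * E j - P * (g * δ j t) := (Dvd.intro _ ht'.symm).trans (hPQ j)
    have h2 : δ j t = t' + z j * δ j t' := by
      rw [ht', Derivation.leibniz, hδ, if_pos rfl, smul_eq_mul, smul_eq_mul]; ring
    -- Modulo z j the derivative δ j t equals t', so `h1` becomes a congruence with the factor t' *
    -- g, which is prime to z j.
    have h3 : z j ∣ (t' * g) * (P - Q * a) := by
      have h4 : (t' * g) * (P - Q * a) =
          -(Q * E j - P * (g * δ j t)) - z j * (P * g * δ j t') := by
        rw [ha, h2]; ring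
      rw [h4]
      exact dvd_sub ((dvd_neg).2 h1) (dvd_mul_right _ _)
    exact (hzj.dvd_or_dvd h3).resolve_left hndvd
  choose a ha using key
  refine ⟨J.filter (fun j => z j ∣ t), a, ?_⟩
  exact (dvd_prod_filter_dvd hz ((Dvd.intro _ rfl).trans hf.dvd)).trans
    (Finset.prod_dvd_prod_of_dvd _ _ ha)

end NormalCrossing

/-! ### Integral equations for a fraction, as ideal membership. -/

/-- The ideal `(t) + (Q P^(m-1), …, Q^m)`: when it contains `P^m`, the fraction `P / Q` is integral
modulo `t`. -/
def integralRelationIdeal {A : Type*} [CommRing A] (t P Q : A) (m : ℕ) : Ideal A :=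
  Ideal.span (insert t ((fun i => Q ^ (m - i) * P ^ i) '' Set.Iio m))

theorem map_integralRelationIdeal {A B : Type*} [CommRing A] [CommRing B] (φ : A →+* B) (t P Q : A)
    (m : ℕ) : (integralRelationIdeal t P Q m).map φ =
      integralRelationIdeal (φ t) (φ P) (φ Q) m := by
  rw [integralRelationIdeal, Ideal.map_span, Set.image_insert_eq, Set.image_image]
  simp only [map_mul, map_pow]
  rfl

-- The product expands to P^m plus multiples of Q^(m-i) P^i with i < m. The resulting membership no
-- longer mentions the a j, which live only on the étale extension, and so it can descend.
open Polynomial in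
theorem pow_mem_integralRelationIdeal {C ι : Type*} [CommRing C] {t P Q : C} {s : Finset ι}
    {a : ι → C} (h : t ∣ ∏ j ∈ s, (P - Q * a j)) :
    P ^ s.card ∈ integralRelationIdeal t P Q s.card := by
  have h1 : ∀ s : Finset ι, ∃ c : ℕ → C, ∏ j ∈ s, (P - Q * a j) =
      P ^ s.card + ∑ i ∈ Finset.range s.card, c i * (Q ^ (s.card - i) * P ^ i) := by
    classical
    intro s
    induction s using Finset.induction_on with
    | empty => exact ⟨0, by simp⟩
    | insert j s hj ih =>
      obtain ⟨c, hc⟩ := ih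
      -- Multiplication by P - Q * a j turns the coefficients c i into c (i - 1) - a j * c i, where
      -- c at `s.card` is read as 1, the coefficient of the leading term.
      refine ⟨fun i => (if i = s.card then - a j else -a j * c i) +
        (match i with | 0 => 0 | i + 1 => c i), ?_⟩
      rw [Finset.prod_insert hj, hc, Finset.card_insert_of_notMem hj]
      simp only [add_mul, Finset.sum_add_distrib]
      rw [Finset.sum_range_succ, Finset.sum_range_succ' _ s.card]
      rw [if_pos rfl]
      have e1 : ∑ i ∈ Finset.range s.card, (if i = s.card then - a j else -a j * c i) *
          (Q ^ (s.card + 1 - i) * P ^ i) =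
          -(a j * Q) * ∑ i ∈ Finset.range s.card, c i * (Q ^ (s.card - i) * P ^ i) := by
        rw [Finset.mul_sum]
        refine Finset.sum_congr rfl fun i hi => ?_
        rw [Finset.mem_range] at hi
        rw [if_neg hi.ne, Nat.succ_sub hi.le, pow_succ]
        ring
      have e2 : ∑ i ∈ Finset.range s.card, c i * (Q ^ (s.card + 1 - (i + 1)) * P ^ (i + 1)) =
          P * ∑ i ∈ Finset.range s.card, c i * (Q ^ (s.card - i) * P ^ i) := by
        rw [Finset.mul_sum]
        refine Finset.sum_congr rfl fun i hi => ?_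
        rw [Nat.succ_sub_succ, pow_succ]
        ring
      rw [e1, e2, Nat.succ_sub le_rfl, Nat.sub_self]
      ring
  obtain ⟨c, hc⟩ := h1 s
  rw [← sub_eq_iff_eq_add] at hc
  rw [← hc]
  refine sub_mem ?_ (Ideal.sum_mem _ fun i hi => Ideal.mul_mem_left _ _ (Ideal.subset_span
    (Set.mem_insert_of_mem _ ⟨i, by simpa using hi, rfl⟩)))
  obtain ⟨w, hw⟩ := h
  rw [hw]
  exact Ideal.mul_mem_right _ _ (Ideal.subset_span (Set.mem_insert _ _))

/-! ### Passage to étale neighbourhoods, and descent. -/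

section EtaleLocal

/-- Derivations extend along formally étale algebras. -/
theorem Derivation.exists_extension_of_formallyEtale {k A C : Type*} [CommRing k] [CommRing A]
    [CommRing C] [Algebra k A] [Algebra k C] [Algebra A C] [IsScalarTower k A C]
    [Algebra.FormallyEtale A C] (d : Derivation k A A) :
    ∃ d' : Derivation k C C, ∀ a, d' (algebraMap A C a) = algebraMap A C (d a) := by
  let l : Ω[A⁄k] →ₗ[A] C := (Algebra.linearMap A C).comp d.liftKaehlerDifferential
  refine ⟨((l.liftBaseChange C).comp
    (tensorKaehlerEquivOfFormallyEtale k A C).symm.toLinearMap).compDer (D k C), fun a => ?_⟩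
  change (l.liftBaseChange C) ((tensorKaehlerEquivOfFormallyEtale k A C).symm
    (D k C (algebraMap A C a))) = _
  rw [tensorKaehlerEquivOfFormallyEtale_symm_D_algebraMap, LinearMap.liftBaseChange_tmul, one_smul]
  change algebraMap A C (d.liftKaehlerDifferential (D k A a)) = _
  rw [Derivation.liftKaehlerDifferential_comp_D]

theorem Derivation.sum_smul_apply {k C ι : Type*} [CommRing k] [CommRing C] [Algebra k C]
    (s : Finset ι) (c : ι → C) (δ : ι → Derivation k C C) (a : C) :
    (∑ l ∈ s, c l • δ l) a = ∑ l ∈ s, c l * δ l a := by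
  have h := congrFun (map_sum (Derivation.coeFnAddMonoidHom (R := k) (A := C) (M := C))
    (fun l => c l • δ l) s) a
  rw [Finset.sum_apply] at h
  exact h

open IsLocalRing

/-- With going-down, the height of the maximal ideal of C is that of A plus the height in the fibre.
-/
theorem IsLocalRing.ringKrullDim_le_of_hasGoingDown {A C : Type*} [CommRing A] [IsLocalRing A]
    [IsNoetherianRing A]
    [CommRing C] [IsLocalRing C] [IsNoetherianRing C] [Algebra A C]
    [IsLocalHom (algebraMap A C)] [Algebra.HasGoingDown A C] :
    ringKrullDim A ≤ ringKrullDim C := by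
  rw [← maximalIdeal_height_eq_ringKrullDim, ← maximalIdeal_height_eq_ringKrullDim]
  have h := Ideal.height_eq_height_add_of_liesOver_of_hasGoingDown (maximalIdeal A) (maximalIdeal C)
  rw [h]
  exact_mod_cast le_self_add

/-- If derivations `δ` are dual to generators of the maximal ideal, they can be changed by an
invertible matrix to become dual to any other generators (as many). -/
theorem exists_dual_derivations {k C : Type*} [CommRing k] [CommRing C] [IsLocalRing C]
    [Algebra k C] {n : ℕ} {y z : Fin n → C} {δ : Fin n → Derivation k C C}
    (hy : ∀ i, y i ∈ maximalIdeal C) (hδ : ∀ i j, δ i (y j) = if i = j then 1 else 0)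
    (hz : Ideal.span (Set.range z) = maximalIdeal C) :
    ∃ M : Matrix (Fin n) (Fin n) C,
      ∀ i j, (∑ l, M i l • δ l) (z j) = if i = j then 1 else 0 := by
  have hzm : ∀ i, z i ∈ maximalIdeal C := fun i => hz ▸ Ideal.subset_span ⟨i, rfl⟩
  have h1 : ∀ j, ∃ c : Fin n → C, ∑ i, c i • z i = y j := fun j =>
    (Submodule.mem_span_range_iff_exists_fun C).1 (by
      have := hy j
      rw [← hz] at this
      exact this)
  choose c hc using h1
  let N : Matrix (Fin n) (Fin n) C := fun i j => δ i (z j)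
  let c' : Matrix (Fin n) (Fin n) C := fun i j => c j i
  -- Apply δ i to y j = ∑ c j l * z l: the terms in which c is differentiated have a factor z l and
  -- vanish in the residue field. So N is invertible modulo the maximal ideal, hence over C.
  have hmod : (N * c').map (residue C) = 1 := by
    ext i j
    rw [Matrix.map_apply, Matrix.mul_apply, map_sum, Matrix.one_apply]
    have h2 := congrArg (residue C) (hδ i j)
    rw [← hc j, map_sum, map_sum] at h2
    have h3 : residue C (if i = j then 1 else 0) = if i = j then 1 else 0 := by
      split_ifs <;> simp
    rw [h3] at h2
    rw [← h2]
    refine Finset.sum_congr rfl fun l _ => ?_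
    have h4 : residue C (z l) = 0 := (residue_eq_zero_iff _).2 (hzm l)
    simp [N, c', h4, mul_comm]
  have hdet : IsUnit N.det := by
    have h5 : IsUnit (residue C (N * c').det) := by
      rw [RingHom.map_det, RingHom.mapMatrix_apply, hmod, Matrix.det_one]
      exact isUnit_one
    rw [Matrix.det_mul] at h5
    exact isUnit_of_mul_isUnit_left ((isUnit_map_iff (residue C) _).1 h5)
  refine ⟨N⁻¹, fun i j => ?_⟩
  have h6 : (∑ l, N⁻¹ i l • δ l) (z j) = (N⁻¹ * N) i j := by
    rw [Matrix.mul_apply, Derivation.sum_smul_apply]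
  rw [h6, Matrix.nonsing_inv_mul _ hdet, Matrix.one_apply]

variable {k A : Type*} [CommRing k] [CommRing A] [IsLocalRing A] [IsNoetherianRing A]
  [Algebra k A] {n : ℕ} {y : Fin n → A} {δ : Fin n → Derivation k A A}

/-- By flatness dim C ≥ n, so C is a domain and the z j are pairwise non-associated primes. The δ i
extend to C, and a change of basis M makes them dual to z. The divisibility hypotheses are linear or
alternating in the derivations, so they survive this change, and the computation on branches applies
in C. -/
theorem exists_pow_mem_integralRelationIdeal_of_formallyEtale {C : Type*} [CommRing C]
    [IsLocalRing C] [IsNoetherianRing C] [Algebra k C] [Algebra A C] [IsScalarTower k A C]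
    [Module.Flat A C] [IsLocalHom (algebraMap A C)] [Algebra.FormallyEtale A C]
    (hy : ∀ i, y i ∈ maximalIdeal A) (hδ : ∀ i j, δ i (y j) = if i = j then 1 else 0)
    (hn : (n : WithBot ℕ∞) ≤ ringKrullDim A) {z : Fin n → C}
    (hz : Ideal.span (Set.range z) = maximalIdeal C) {J : Finset (Fin n)} {t g : A}
    (hf : Associated (algebraMap A C (t * g)) (∏ j ∈ J, z j)) {E : Fin n → A}
    (hE : ∀ i j, t * g ∣ δ i (t * g) * E j - δ j (t * g) * E i)
    {P Q : A} (hPQ : ∀ j, t ∣ Q * E j - P * (g * δ j t)) :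
    ∃ m, P ^ m ∈ integralRelationIdeal t P Q m := by
  have hnC : (n : WithBot ℕ∞) ≤ ringKrullDim C :=
    hn.trans IsLocalRing.ringKrullDim_le_of_hasGoingDown
  have : IsDomain C := IsLocalRing.isDomain_of_span_eq_maximalIdeal n C z hz hnC
  choose δ' hδ' using fun i => (δ i).exists_extension_of_formallyEtale (C := C)
  obtain ⟨M, hM⟩ := exists_dual_derivations (y := fun i => algebraMap A C (y i)) (δ := δ') (z := z)
    (fun i => ((local_hom_TFAE (algebraMap A C)).out 0 2 rfl rfl).1 inferInstance
      (Ideal.mem_map_of_mem _ (hy i)))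
    (fun i j => by rw [hδ', hδ]; split_ifs <;> simp) hz
  have hsum : ∀ i (a : A), (∑ l, M i l • δ' l) (algebraMap A C a) =
      ∑ l, M i l * algebraMap A C (δ l a) := fun i a => by
    rw [Derivation.sum_smul_apply]
    exact Finset.sum_congr rfl fun l _ => by rw [hδ']
  obtain ⟨s, a, hs⟩ := exists_dvd_prod_sub_mul (J := J) (z := z) (δ := fun i => ∑ l, M i l • δ' l)
    (fun j _ => IsLocalRing.prime_of_le_ringKrullDim hz hnC j)
    (fun i _ j _ hij => IsLocalRing.not_dvd_of_le_ringKrullDim hz hnC hij) hM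
    (t := algebraMap A C t) (g := algebraMap A C g) (by rwa [← map_mul])
    (E := fun i => ∑ l, M i l * algebraMap A C (E l))
    (fun i j => by
      have h1 : (∑ l, M i l • δ' l) (algebraMap A C t * algebraMap A C g) *
          (∑ l, M j l * algebraMap A C (E l)) - (∑ l, M j l • δ' l)
            (algebraMap A C t * algebraMap A C g) * (∑ l, M i l * algebraMap A C (E l)) =
          ∑ l, ∑ l', M i l * M j l' *
            algebraMap A C (δ l (t * g) * E l' - δ l' (t * g) * E l) := by
        rw [← map_mul, hsum, hsum, Finset.sum_mul_sum, mul_comm (∑ l, M j l * _),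
          Finset.sum_mul_sum, ← Finset.sum_sub_distrib]
        refine Finset.sum_congr rfl fun l _ => ?_
        rw [← Finset.sum_sub_distrib]
        refine Finset.sum_congr rfl fun l' _ => ?_
        rw [map_sub, map_mul (algebraMap A C), map_mul (algebraMap A C)]
        ring
      rw [h1, ← map_mul]
      exact Finset.dvd_sum fun l _ => Finset.dvd_sum fun l' _ =>
        Dvd.dvd.mul_left (map_dvd _ (hE l l')) _)
    (P := algebraMap A C P) (Q := algebraMap A C Q)
    (fun j => by
      have h1 : algebraMap A C Q * (∑ l, M j l * algebraMap A C (E l)) - algebraMap A C P *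
          (algebraMap A C g * (∑ l, M j l • δ' l) (algebraMap A C t)) =
          ∑ l, M j l * algebraMap A C (Q * E l - P * (g * δ l t)) := by
        rw [hsum, Finset.mul_sum, Finset.mul_sum, Finset.mul_sum, ← Finset.sum_sub_distrib]
        refine Finset.sum_congr rfl fun l _ => ?_
        simp only [map_sub, map_mul (algebraMap A C)]
        ring
      rw [h1]
      exact Finset.dvd_sum fun l _ => Dvd.dvd.mul_left (map_dvd _ (hPQ l)) _)
  have hmem := pow_mem_integralRelationIdeal hs
  rw [← map_pow, ← map_integralRelationIdeal, ← Ideal.mem_comap] at hmem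
  -- The ideal is extended from A, so by faithful flatness its contraction is itself.
  have : Module.FaithfullyFlat A C := Module.FaithfullyFlat.of_flat_of_isLocalHom
  rw [Ideal.comap_map_eq_self_of_faithfullyFlat] at hmem
  exact ⟨_, hmem⟩

/-- Near a normal crossing point (tested on an étale algebra `B` at a prime `q`), the residue
`P / Q` of a logarithmic form along a component `t = 0` of the divisor `t g = 0` is integral
over the local ring of the component. -/
theorem exists_pow_mem_integralRelationIdeal_of_etale {B : Type*} [CommRing B]
    [Algebra A B] [Algebra.Etale A B] (q : Ideal B) [q.IsPrime]
    (hq : ∀ b : A, algebraMap A B b ∈ q ↔ ¬ IsUnit b)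
    (hy : ∀ i, y i ∈ maximalIdeal A) (hδ : ∀ i j, δ i (y j) = if i = j then 1 else 0)
    (hn : (n : WithBot ℕ∞) ≤ ringKrullDim A) {z : Fin n → Localization.AtPrime q}
    (hz : Ideal.span (Set.range z) = maximalIdeal (Localization.AtPrime q)) {J : Finset (Fin n)}
    {t g : A} (hf : Associated (algebraMap B (Localization.AtPrime q) (algebraMap A B (t * g)))
      (∏ j ∈ J, z j)) {E : Fin n → A}
    (hE : ∀ i j, t * g ∣ δ i (t * g) * E j - δ j (t * g) * E i)
    {P Q : A} (hPQ : ∀ j, t ∣ Q * E j - P * (g * δ j t)) :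
    ∃ m, P ^ m ∈ integralRelationIdeal t P Q m := by
  have : IsNoetherianRing B := Algebra.FiniteType.isNoetherianRing A B
  have : IsNoetherianRing (Localization.AtPrime q) :=
    IsLocalization.isNoetherianRing q.primeCompl _ inferInstance
  let : Algebra k (Localization.AtPrime q) :=
    ((algebraMap A (Localization.AtPrime q)).comp (algebraMap k A)).toAlgebra
  have : IsScalarTower k A (Localization.AtPrime q) := IsScalarTower.of_algebraMap_eq fun _ => rfl
  have : Module.Flat A (Localization.AtPrime q) := Module.Flat.trans A B _
  have : Algebra.FormallyEtale B (Localization.AtPrime q) := .of_isLocalization q.primeCompl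
  have : Algebra.FormallyEtale A (Localization.AtPrime q) := .comp A B _
  have : IsLocalHom (algebraMap A (Localization.AtPrime q)) := ⟨fun b hb => by
    by_contra h
    have h1 := (hq b).2 h
    rw [IsScalarTower.algebraMap_apply A B (Localization.AtPrime q),
      IsLocalization.AtPrime.isUnit_to_map_iff _ q] at hb
    exact hb h1⟩
  refine exists_pow_mem_integralRelationIdeal_of_formallyEtale hy hδ hn hz (J := J) ?_ hE hPQ
  rwa [IsScalarTower.algebraMap_apply A B (Localization.AtPrime q)]

end EtaleLocal

/-! ### Homogeneous polynomials, partial derivatives and the Nullstellensatz. -/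

namespace MvPolynomial

section Homogeneous

variable {σ R : Type*} [CommRing R]

theorem IsHomogeneous.homogeneousComponent_mul {q : MvPolynomial σ R} {d : ℕ}
    (hq : q.IsHomogeneous d) (p : MvPolynomial σ R) (i : ℕ) :
    homogeneousComponent (i + d) (p * q) = homogeneousComponent i p * q := by
  conv_lhs => rw [← sum_homogeneousComponent p, Finset.sum_mul, map_sum]
  have h : ∀ j, homogeneousComponent (i + d) (homogeneousComponent j p * q) =
      if j = i then homogeneousComponent j p * q else 0 := fun j => by
    rw [homogeneousComponent_of_mem ((homogeneousComponent_isHomogeneous j p).mul hq)]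
    by_cases hji : j = i
    · simp [hji]
    · rw [if_neg hji, if_neg (by omega)]
  simp only [h, Finset.sum_ite_eq', Finset.mem_range]
  split_ifs with hi
  · rfl
  · rw [homogeneousComponent_eq_zero _ _ (by omega), zero_mul]

theorem IsHomogeneous.dvd_homogeneousComponent_mul {q : MvPolynomial σ R} {d : ℕ}
    (hq : q.IsHomogeneous d) (p : MvPolynomial σ R) (N : ℕ) :
    q ∣ homogeneousComponent N (p * q) := by
  rw [← sum_homogeneousComponent p, Finset.sum_mul, map_sum]
  refine Finset.dvd_sum fun j _ => ?_
  rw [homogeneousComponent_of_mem ((homogeneousComponent_isHomogeneous j p).mul hq)]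
  split_ifs
  · exact dvd_mul_left _ _
  · exact dvd_zero _

theorem IsHomogeneous.of_mul_right [IsDomain R] {p q : MvPolynomial σ R} {e d : ℕ}
    (hq : q.IsHomogeneous d) (hq0 : q ≠ 0) (h : (p * q).IsHomogeneous (e + d)) :
    p.IsHomogeneous e := by
  have h1 : homogeneousComponent e p = p := by
    apply mul_right_cancel₀ hq0
    rw [← hq.homogeneousComponent_mul, homogeneousComponent_eq_self h]
  rw [← h1]
  exact homogeneousComponent_isHomogeneous e p

theorem IsHomogeneous.aeval_smul {S : Type*} [CommRing S] [Algebra R S] {f : MvPolynomial σ R}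
    {d : ℕ} (hf : f.IsHomogeneous d) (c : S) (v : σ → S) :
    MvPolynomial.aeval (fun i => c * v i) f = c ^ d * MvPolynomial.aeval v f := by
  rw [aeval_def, aeval_def, eval₂_eq, eval₂_eq, Finset.mul_sum]
  refine Finset.sum_congr rfl fun m hm => ?_
  simp only [mul_pow, Finset.prod_mul_distrib]
  rw [Finset.prod_pow_eq_pow_sum]
  have h : ∑ i ∈ m.support, m i = d := (hf.degree_eq_sum_deg_support hm).symm
  rw [h]
  ring

theorem IsHomogeneous.X_mul_pderiv {f : MvPolynomial σ R} {d : ℕ} (hf : f.IsHomogeneous d)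
    (i j : σ) : (X i * pderiv j f).IsHomogeneous d := by
  obtain _ | d := d
  · have h := hf
    rw [← totalDegree_zero_iff_isHomogeneous, totalDegree_eq_zero_iff_eq_C] at h
    rw [h, pderiv_C, mul_zero]
    exact isHomogeneous_zero _ _ _
  · have h := (isHomogeneous_X R i).mul (hf.pderiv (i := j))
    rwa [Nat.add_sub_cancel, add_comm] at h

end Homogeneous

variable {k σ : Type*} [Field k]

/-- If all partial derivatives vanish, every exponent is zero in k. In characteristic p the
polynomial is then a p-th power, since the coefficients have p-th roots; in characteristic 0 it is
constant. Neither is irreducible. -/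
theorem exists_pderiv_ne_zero [PerfectField k] [Finite σ] {h : MvPolynomial σ k}
    (hh : Irreducible h) : ∃ j, pderiv j h ≠ 0 := by
  by_contra! hcon
  have hsupp : ∀ m ∈ h.support, ∀ i, (m i : k) = 0 := by
    classical
    intro m hm i
    rcases Nat.eq_zero_or_pos (m i) with h0 | h0
    · rw [h0, Nat.cast_zero]
    have h1 := coeff_pderiv (i := i) h (m - Finsupp.single i 1)
    have h2 : m - Finsupp.single i 1 + Finsupp.single i 1 = m :=
      tsub_add_cancel_of_le (by rwa [Finsupp.single_le_iff])
    rw [hcon i, coeff_zero, h2] at h1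
    have h3 := (mul_eq_zero.1 h1.symm).resolve_left (mem_support_iff.1 hm)
    rw [← h2]
    simpa using h3
  obtain ⟨p, hp⟩ := CharP.exists k
  rcases CharP.char_is_prime_or_zero k p with hprime | rfl
  · have : Fact p.Prime := ⟨hprime⟩
    have : ExpChar k p := .prime hprime
    have : PerfectRing k p := PerfectField.toPerfectRing p
    have hpow : h = (∑ m ∈ h.support,
        monomial (m.mapRange (· / p) (Nat.zero_div p)) ((frobeniusEquiv k p).symm (coeff m h))) ^ p := by
      rw [sum_pow_char]
      conv_lhs => rw [as_sum h]
      refine Finset.sum_congr rfl fun m hm => ?_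
      rw [monomial_pow]
      refine congrArg₂ (fun a b => monomial a b) (Finsupp.ext fun i => ?_) ?_
      · have := (CharP.cast_eq_zero_iff k p (m i)).1 (hsupp m hm i)
        simp [Nat.mul_div_cancel' this]
      · exact (frobeniusEquiv_symm_pow_p k p _).symm
    rw [hpow] at hh
    exact not_irreducible_pow hprime.one_lt.ne' hh
  · classical
    have : CharZero k := CharP.charP_to_charZero k
    have hC : h = C (coeff 0 h) := by
      ext m
      rw [coeff_C]
      split_ifs with hm
      · rw [hm]
      · by_contra h0
        apply hm
        ext i
        simpa using (Nat.cast_eq_zero.1 (hsupp m (mem_support_iff.2 h0) i)).symm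
    have hne : coeff 0 h ≠ 0 := by
      intro h0
      rw [h0, C_0] at hC
      exact hh.ne_zero hC
    apply hh.not_isUnit
    rw [hC]
    exact (IsUnit.mk0 _ hne).map C

theorem exists_mem_forall_eval_eq_zero_of_notMem [IsAlgClosed k] [Finite σ]
    (P : Ideal (MvPolynomial σ k)) [P.IsPrime] {f : MvPolynomial σ k} (hf : f ∉ P) :
    ∃ x : σ → k, (∀ p ∈ P, eval x p = 0) ∧ eval x f ≠ 0 := by
  by_contra! hcon
  apply hf
  rw [← IsPrime.vanishingIdeal_zeroLocus (K := k) P, mem_vanishingIdeal_iff]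
  intro x hx
  rw [aeval_eq_eval]
  exact hcon x fun p hp => by
    have := (mem_zeroLocus_iff.1 hx) p hp
    rwa [aeval_eq_eval] at this

/-- With at least two variables, p cannot divide them all. The Nullstellensatz then gives a zero of
p at which some coordinate does not vanish. -/
theorem exists_ne_zero_eval_eq_zero [IsAlgClosed k] {n : ℕ} (hn : n ≠ 0)
    {p : MvPolynomial (Fin (n + 1)) k} (hp : Irreducible p) :
    ∃ x : Fin (n + 1) → k, x ≠ 0 ∧ eval x p = 0 := by
  have : (Ideal.span {p}).IsPrime := (Ideal.span_singleton_prime hp.ne_zero).2 hp.prime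
  obtain ⟨i, hi⟩ : ∃ i, ¬ p ∣ X i := by
    by_contra! hcon
    have h01 : (0 : Fin (n + 1)) ≠ Fin.last n := by
      intro h
      exact hn (by simpa using (congrArg Fin.val h).symm)
    have h0 := (hp.associated_of_dvd (X_prime (R := k) (i := (0 : Fin (n + 1)))).irreducible
      (hcon 0))
    exact h01 (X_dvd_X.1 (h0.symm.dvd.trans (hcon (Fin.last n))))
  obtain ⟨x, hx, hxi⟩ := exists_mem_forall_eval_eq_zero_of_notMem (Ideal.span {p}) (f := X i)
    (by rwa [Ideal.mem_span_singleton])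
  refine ⟨x, ?_, hx p (Ideal.mem_span_singleton_self p)⟩
  rintro rfl
  simp at hxi

/-- A binary form that vanishes at a point of the projective line is divisible by the linear
equation of the point. -/
theorem IsHomogeneous.dvd_of_eval_eq_zero {f : MvPolynomial (Fin 2) k} {d : ℕ}
    (hf : f.IsHomogeneous d) {x : Fin 2 → k} (hx : x ≠ 0) (h0 : eval x f = 0) :
    C (x 0) * X 1 - C (x 1) * X 0 ∣ f := by
  set l : MvPolynomial (Fin 2) k := C (x 0) * X 1 - C (x 1) * X 0 with hl
  obtain ⟨i, hi⟩ := Function.ne_iff.1 hx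
  let q := Ideal.Quotient.mkₐ k (Ideal.span {l})
  have hq : q (C (x 0) * X 1) = q (C (x 1) * X 0) := by
    rw [← sub_eq_zero, ← map_sub]
    exact Ideal.Quotient.eq_zero_iff_mem.2 (Ideal.mem_span_singleton_self _)
  -- Modulo l the vectors X and x are proportional, so homogeneity gives x_i^d f(X) = X_i^d f(x) =
  -- 0.
  have hrel : ∀ j, q (C (x i)) * q (X j) = q (X i) * q (C (x j)) := by
    intro j
    simp only [map_mul] at hq
    fin_cases i <;> fin_cases j <;> simp only [Fin.zero_eta, Fin.mk_one, Fin.isValue]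
    · ring
    · rw [hq]; ring
    · rw [← hq]; ring
    · ring
  have h1 : q (C (x i)) ^ d * q f = 0 := by
    have h2 : q f = MvPolynomial.aeval (fun j => q (X j)) f := by
      rw [← comp_aeval_apply, aeval_X_left_apply]
    rw [h2, ← hf.aeval_smul]
    simp only [hrel]
    rw [hf.aeval_smul]
    have h3 : MvPolynomial.aeval (fun j => q (C (x j))) f = q (C (eval x f)) := by
      have h4 : (fun j => q (C (x j))) = fun j => (q.comp (Algebra.ofId k _)) (x j) := rfl
      rw [h4, ← comp_aeval_apply, aeval_eq_eval]
      rfl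
    rw [h3, h0, map_zero, map_zero, mul_zero]
  have hu : IsUnit (q (C (x i)) ^ d) := (((IsUnit.mk0 _ hi).map C).map q).pow d
  rw [hu.mul_right_eq_zero] at h1
  exact Ideal.mem_span_singleton.1 (Ideal.Quotient.eq_zero_iff_mem.1 h1)

variable [IsAlgClosed k] [Finite σ]

/-- The ideal of a point of affine `n`-space has height at least `n`. -/
theorem natCard_le_height_vanishingIdeal_singleton (a : σ → k) :
    (Nat.card σ : ℕ∞) ≤ (vanishingIdeal k {a}).height := by
  have hdim : ringKrullDim (MvPolynomial σ k) = Nat.card σ := by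
    rw [MvPolynomial.ringKrullDim_of_isNoetherianRing, ringKrullDim_eq_zero_of_field, zero_add]
  have hle : ringKrullDim (MvPolynomial σ k) ≤ ((vanishingIdeal k {a}).height : WithBot ℕ∞) := by
    rw [ringKrullDim_le_iff_isMaximal_height_le]
    intro M hM
    obtain ⟨b, rfl⟩ := isMaximal_iff_eq_vanishingIdeal_singleton.1 hM
    -- Translations permute the points, so all maximal ideals have the same height. It is therefore
    -- enough to bound the dimension by the heights of all of them.
    let τ : (σ → k) → MvPolynomial σ k →ₐ[k] MvPolynomial σ k := fun c => aeval fun i => X i + C (c i)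
    have hτ : ∀ c, (τ (-c)).comp (τ c) = AlgHom.id k _ := fun c => by
      ext i
      simp [τ]
    let e : MvPolynomial σ k ≃ₐ[k] MvPolynomial σ k := AlgEquiv.ofAlgHom (τ (b - a)) (τ (a - b))
      (by have := hτ (a - b); rwa [neg_sub] at this) (by have := hτ (b - a); rwa [neg_sub] at this)
    have he : vanishingIdeal k {a} = (vanishingIdeal k {b}).comap (e.symm : _ ≃+* _) := by
      ext p
      rw [Ideal.mem_comap, mem_vanishingIdeal_singleton_iff, mem_vanishingIdeal_singleton_iff]
      change _ ↔ aeval b (τ (a - b) p) = 0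
      have h1 : (aeval b).comp (τ (a - b)) = aeval a := by
        ext i; simp [τ]
      rw [← h1, AlgHom.comp_apply]
    rw [he, RingEquiv.height_comap]
  rw [hdim] at hle
  exact_mod_cast hle

end MvPolynomial

/-! ### The derivations xᵢ ∂/∂xⱼ on the function field and on the local rings. -/

namespace LogForms

open MvPolynomial

noncomputable section

universe u

variable {k : Type u} [Field k] {n : ℕ}

theorem algebraMap_ratFun_injective :
    Function.Injective (algebraMap (CoordRing k n) (RatFun k n)) :=
  IsFractionRing.injective _ _

theorem algebraMap_ratFun_ne_zero {g : CoordRing k n} (hg : g ≠ 0) :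
    algebraMap (CoordRing k n) (RatFun k n) g ≠ 0 :=
  (map_ne_zero_iff _ algebraMap_ratFun_injective).2 hg

theorem ne_zero_of_eval_ne_zero {x : Fin (n + 1) → k} {g : CoordRing k n} (hg : eval x g ≠ 0) :
    g ≠ 0 := by
  rintro rfl
  simp at hg

theorem algebraMap_functionField_injective :
    Function.Injective (algebraMap (FunctionField k n) (RatFun k n)) :=
  (algebraMap (FunctionField k n) (RatFun k n)).injective

theorem exists_algebraMap_eq_div {d : ℕ} {f g : CoordRing k n} (hf : f.IsHomogeneous d)
    (hg : g.IsHomogeneous d) (h0 : g ≠ 0) :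
    ∃ z : FunctionField k n, algebraMap (FunctionField k n) (RatFun k n) z =
      algebraMap (CoordRing k n) (RatFun k n) f / algebraMap (CoordRing k n) (RatFun k n) g :=
  ⟨⟨_, d, f, g, hf, hg, h0, rfl⟩, rfl⟩

theorem exists_div_eq_algebraMap (z : FunctionField k n) :
    ∃ (d : ℕ) (f g : CoordRing k n), f.IsHomogeneous d ∧ g.IsHomogeneous d ∧ g ≠ 0 ∧
      algebraMap (FunctionField k n) (RatFun k n) z =
        algebraMap (CoordRing k n) (RatFun k n) f / algebraMap (CoordRing k n) (RatFun k n) g :=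
  z.2

variable (k n) in
/-- The partial derivative `∂/∂xⱼ` of rational functions. -/
def ratPderiv (j : Fin (n + 1)) : Derivation k (RatFun k n) (RatFun k n) :=
  haveI : Algebra.FormallyEtale (CoordRing k n) (RatFun k n) :=
    .of_isLocalization (nonZeroDivisors (CoordRing k n))
  (Derivation.exists_extension_of_formallyEtale (C := RatFun k n)
    (pderiv (R := k) j)).choose

theorem ratPderiv_algebraMap (j : Fin (n + 1)) (f : CoordRing k n) :
    ratPderiv k n j (algebraMap _ _ f) = algebraMap (CoordRing k n) (RatFun k n) (pderiv j f) :=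
  haveI : Algebra.FormallyEtale (CoordRing k n) (RatFun k n) :=
    .of_isLocalization (nonZeroDivisors (CoordRing k n))
  (Derivation.exists_extension_of_formallyEtale (C := RatFun k n)
    (pderiv (R := k) j)).choose_spec f

theorem ratPderiv_div (j : Fin (n + 1)) (f : CoordRing k n) {g : CoordRing k n} (hg : g ≠ 0) :
    ratPderiv k n j (algebraMap (CoordRing k n) (RatFun k n) f / algebraMap (CoordRing k n) (RatFun k n) g) =
      algebraMap (CoordRing k n) (RatFun k n) (g * pderiv j f - f * pderiv j g) /
        algebraMap (CoordRing k n) (RatFun k n) (g * g) := by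
  have hg' := algebraMap_ratFun_ne_zero hg
  rw [Derivation.leibniz_div, ratPderiv_algebraMap, ratPderiv_algebraMap, smul_eq_mul, smul_eq_mul,
    smul_eq_mul, map_sub, map_mul, map_mul, map_mul]
  field_simp

theorem ratPderiv_comm (i j : Fin (n + 1)) (z : RatFun k n) :
    ratPderiv k n i (ratPderiv k n j z) = ratPderiv k n j (ratPderiv k n i z) := by
  have h : ⁅ratPderiv k n i, ratPderiv k n j⁆ = 0 := by
    have h0 : ∀ f : CoordRing k n, ⁅ratPderiv k n i, ratPderiv k n j⁆ (algebraMap _ _ f) = 0 := by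
      intro f
      rw [Derivation.commutator_apply, ratPderiv_algebraMap, ratPderiv_algebraMap,
        ratPderiv_algebraMap, ratPderiv_algebraMap, sub_eq_zero]
      congr 1
      have : ⁅pderiv (R := k) i, pderiv (R := k) j⁆ = 0 := by
        apply MvPolynomial.derivation_ext
        intro l
        rw [Derivation.commutator_apply]
        classical
        simp only [pderiv_X, Pi.single_apply]
        split_ifs <;> simp
      have h2 := congrArg (fun d => d f) this
      simpa [Derivation.commutator_apply, sub_eq_zero] using h2
    ext z
    obtain ⟨a, b, hb, rfl⟩ := IsFractionRing.div_surjective (A := CoordRing k n) z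
    rw [Derivation.leibniz_div, h0, h0]
    simp
  have h2 := congrArg (fun d => d z) h
  simpa [Derivation.commutator_apply, sub_eq_zero] using h2

theorem X_mul_ratPderiv_div (i j : Fin (n + 1)) {f g : CoordRing k n} (hg : g ≠ 0) :
    algebraMap (CoordRing k n) (RatFun k n) (X i) *
      ratPderiv k n j (algebraMap (CoordRing k n) (RatFun k n) f / algebraMap (CoordRing k n) (RatFun k n) g) =
      algebraMap (CoordRing k n) (RatFun k n) (g * (X i * pderiv j f) - f * (X i * pderiv j g)) /
        algebraMap (CoordRing k n) (RatFun k n) (g * g) := by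
  rw [ratPderiv_div j f hg, mul_div_assoc', ← map_mul]
  congr 2
  ring

theorem isHomogeneous_mul_sub_mul {d : ℕ} {f g : CoordRing k n} (hf : f.IsHomogeneous d)
    (hg : g.IsHomogeneous d) (i j : Fin (n + 1)) :
    (g * (X i * pderiv j f) - f * (X i * pderiv j g)).IsHomogeneous (d + d) :=
  (hg.mul (hf.X_mul_pderiv i j)).sub (hf.mul (hg.X_mul_pderiv i j))

/-- The operator xᵢ ∂/∂xⱼ has degree 0, while ∂/∂xⱼ alone does not preserve the function field. -/
theorem exists_algebraMap_eq_X_mul_ratPderiv (i j : Fin (n + 1)) (z : FunctionField k n) :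
    ∃ w : FunctionField k n, algebraMap (FunctionField k n) (RatFun k n) w =
      algebraMap (CoordRing k n) (RatFun k n) (X i) *
        ratPderiv k n j (algebraMap (FunctionField k n) (RatFun k n) z) := by
  obtain ⟨d, f, g, hf, hg, h0, e⟩ := exists_div_eq_algebraMap z
  rw [e, X_mul_ratPderiv_div i j h0]
  exact exists_algebraMap_eq_div (isHomogeneous_mul_sub_mul hf hg i j) (hg.mul hg)
    (mul_ne_zero h0 h0)

theorem algebraMap_functionField_smul (c : k) (z : FunctionField k n) :
    algebraMap (FunctionField k n) (RatFun k n) (c • z) =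
      c • algebraMap (FunctionField k n) (RatFun k n) z := by
  rw [Algebra.smul_def, Algebra.smul_def, map_mul, ← IsScalarTower.algebraMap_apply]

theorem exists_eulerDerivation (i j : Fin (n + 1)) :
    ∃ δ : Derivation k (FunctionField k n) (FunctionField k n), ∀ z,
      algebraMap (FunctionField k n) (RatFun k n) (δ z) =
        algebraMap (CoordRing k n) (RatFun k n) (X i) *
          ratPderiv k n j (algebraMap (FunctionField k n) (RatFun k n) z) := by
  choose f hf using exists_algebraMap_eq_X_mul_ratPderiv (k := k) i j
  exact ⟨Derivation.mk'
    { toFun := f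
      map_add' := fun a b => algebraMap_functionField_injective (by
        simp only [map_add, hf, mul_add])
      map_smul' := fun c a => algebraMap_functionField_injective (by
        rw [RingHom.id_apply, hf, algebraMap_functionField_smul, algebraMap_functionField_smul, hf,
          Derivation.map_smul, mul_smul_comm]) }
    (fun a b => algebraMap_functionField_injective (by
      simp only [LinearMap.coe_mk, AddHom.coe_mk, smul_eq_mul, map_add, map_mul, hf,
        Derivation.leibniz]
      ring)), hf⟩

variable (k n) in
/-- The derivation `xᵢ ∂/∂xⱼ` of the function field of `ℙⁿ`. -/
def eulerDerivation (i j : Fin (n + 1)) : Derivation k (FunctionField k n) (FunctionField k n) :=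
  (exists_eulerDerivation i j).choose

theorem algebraMap_eulerDerivation (i j : Fin (n + 1)) (z : FunctionField k n) :
    algebraMap (FunctionField k n) (RatFun k n) (eulerDerivation k n i j z) =
      algebraMap (CoordRing k n) (RatFun k n) (X i) *
        ratPderiv k n j (algebraMap (FunctionField k n) (RatFun k n) z) :=
  (exists_eulerDerivation i j).choose_spec z

/-- For j, l ≠ i the factor xᵢ is a constant of both partial derivatives. On the chart xᵢ ≠ 0 these
operators are the partial derivatives in the affine coordinates xⱼ / xᵢ. -/
theorem eulerDerivation_comm {i j l : Fin (n + 1)} (hj : j ≠ i) (hl : l ≠ i)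
    (z : FunctionField k n) : eulerDerivation k n i j (eulerDerivation k n i l z) =
      eulerDerivation k n i l (eulerDerivation k n i j z) := by
  apply algebraMap_functionField_injective
  simp only [algebraMap_eulerDerivation, Derivation.leibniz, ratPderiv_algebraMap,
    pderiv_X_of_ne hj.symm, pderiv_X_of_ne hl.symm, map_zero, smul_eq_mul, mul_zero, add_zero]
  rw [ratPderiv_comm]

section LocalRing

variable {x : Fin (n + 1) → k}

theorem mem_localRing_iff {z : FunctionField k n} : z ∈ localRing x ↔
    ∃ (d : ℕ) (f g : CoordRing k n), f.IsHomogeneous d ∧ g.IsHomogeneous d ∧ eval x g ≠ 0 ∧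
      algebraMap (FunctionField k n) (RatFun k n) z =
        algebraMap (CoordRing k n) (RatFun k n) f / algebraMap (CoordRing k n) (RatFun k n) g :=
  Iff.rfl

variable (x) in
theorem exists_localRing_eq_div {d : ℕ} {f g : CoordRing k n} (hf : f.IsHomogeneous d)
    (hg : g.IsHomogeneous d) (h0 : eval x g ≠ 0) :
    ∃ z : localRing x, algebraMap (FunctionField k n) (RatFun k n) z =
      algebraMap (CoordRing k n) (RatFun k n) f / algebraMap (CoordRing k n) (RatFun k n) g := by
  obtain ⟨z, hz⟩ := exists_algebraMap_eq_div hf hg (ne_zero_of_eval_ne_zero h0)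
  exact ⟨⟨z, d, f, g, hf, hg, h0, hz⟩, hz⟩

theorem eulerDerivation_mem_localRing (i j : Fin (n + 1)) {z : FunctionField k n}
    (hz : z ∈ localRing x) : eulerDerivation k n i j z ∈ localRing x := by
  obtain ⟨d, f, g, hf, hg, h0, e⟩ := mem_localRing_iff.1 hz
  refine mem_localRing_iff.2 ⟨d + d, _, g * g, isHomogeneous_mul_sub_mul hf hg i j, hg.mul hg, ?_, ?_⟩
  · rw [map_mul]; exact mul_ne_zero h0 h0
  · rw [algebraMap_eulerDerivation, e, X_mul_ratPderiv_div i j (ne_zero_of_eval_ne_zero h0)]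

variable (x) in
/-- The derivation `xᵢ ∂/∂xⱼ` of the local ring of a point of `ℙⁿ`. -/
def localEulerDerivation (i j : Fin (n + 1)) : Derivation k (localRing x) (localRing x) :=
  Derivation.mk'
    { toFun := fun z => ⟨eulerDerivation k n i j z, eulerDerivation_mem_localRing i j z.2⟩
      map_add' := fun a b => Subtype.ext (by simp)
      map_smul' := fun c a => Subtype.ext (by simp) }
    (fun a b => Subtype.ext (by simp))

theorem coe_localEulerDerivation (i j : Fin (n + 1)) (z : localRing x) :
    (localEulerDerivation x i j z : FunctionField k n) = eulerDerivation k n i j z :=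
  rfl

end LocalRing

end

noncomputable section

universe u

variable {k : Type u} [Field k] {n : ℕ}

/-! ### Affine charts: local rings of projective space as localizations. -/

section Affine

variable (k) in
/-- Dehomogenization with respect to the coordinate `xᵢ`. -/
def dehomogenize (i : Fin (n + 1)) : CoordRing k n →ₐ[k] MvPolynomial (Fin n) k :=
  aeval (i.insertNth 1 X)

theorem aeval_dehomogenize {B : Type*} [Field B] [Algebra k B] (i : Fin (n + 1))
    {v : Fin (n + 1) → B} (hv : v i ≠ 0) {d : ℕ} {f : CoordRing k n} (hf : f.IsHomogeneous d) :
    aeval (fun j => v (i.succAbove j) / v i) (dehomogenize k i f) = aeval v f / v i ^ d := by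
  have h : (aeval (fun j => v (i.succAbove j) / v i)).comp (dehomogenize k i) =
      aeval (R := k) fun j => (v i)⁻¹ * v j := by
    apply MvPolynomial.algHom_ext
    intro j
    rw [AlgHom.comp_apply, dehomogenize, aeval_X, aeval_X]
    refine Fin.succAboveCases i ?_ (fun l => ?_) j
    · rw [Fin.insertNth_apply_same, map_one, inv_mul_cancel₀ hv]
    · rw [Fin.insertNth_apply_succAbove, aeval_X, div_eq_inv_mul]
  rw [← AlgHom.comp_apply, h, hf.aeval_smul, inv_pow, div_eq_inv_mul]

theorem exists_dehomogenize_eq (i : Fin (n + 1)) (p : MvPolynomial (Fin n) k) :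
    ∃ (d : ℕ) (f : CoordRing k n), f.IsHomogeneous d ∧ dehomogenize k i f = p := by
  have hX : dehomogenize k i (X i) = 1 := by
    rw [dehomogenize, aeval_X, Fin.insertNth_apply_same]
  induction p using MvPolynomial.induction_on with
  | C a => exact ⟨0, C a, isHomogeneous_C _ _, (dehomogenize k i).commutes a⟩
  | add p q hp hq =>
    obtain ⟨d, f, hf, rfl⟩ := hp
    obtain ⟨e, g, hg, rfl⟩ := hq
    refine ⟨d + e, f * X i ^ e + g * X i ^ d,
      (hf.mul (isHomogeneous_X_pow i e)).add ?_, by simp [hX]⟩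
    rw [add_comm d e]
    exact hg.mul (isHomogeneous_X_pow i d)
  | mul_X p j hp =>
    obtain ⟨d, f, hf, rfl⟩ := hp
    refine ⟨d + 1, f * X (i.succAbove j), hf.mul (isHomogeneous_X _ _), ?_⟩
    rw [map_mul, dehomogenize, aeval_X, Fin.insertNth_apply_succAbove]

variable {x : Fin (n + 1) → k} {i : Fin (n + 1)}

theorem exists_algHom_localRing (hi : x i ≠ 0) :
    ∃ φ : MvPolynomial (Fin n) k →ₐ[k] localRing x, ∀ (d : ℕ) (f : CoordRing k n),
      f.IsHomogeneous d →
      algebraMap (FunctionField k n) (RatFun k n) (φ (dehomogenize k i f)) =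
        algebraMap (CoordRing k n) (RatFun k n) f /
          algebraMap (CoordRing k n) (RatFun k n) (X i ^ d) := by
  choose y hy using fun j : Fin n => exists_localRing_eq_div x (isHomogeneous_X k (i.succAbove j))
    (isHomogeneous_X k i) (by rwa [eval_X])
  refine ⟨aeval y, fun d f hf => ?_⟩
  have h : ((IsScalarTower.toAlgHom k (FunctionField k n) (RatFun k n)).comp
      (localRing x).val).comp (aeval y) =
      aeval fun j => algebraMap (CoordRing k n) (RatFun k n) (X (i.succAbove j)) /
        algebraMap (CoordRing k n) (RatFun k n) (X i) := by
    apply MvPolynomial.algHom_ext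
    intro j
    rw [aeval_X, AlgHom.comp_apply, aeval_X]
    exact hy j
  have h2 := congrArg (fun g => g (dehomogenize k i f)) h
  refine h2.trans ?_
  rw [map_pow]
  refine (aeval_dehomogenize i (v := fun j => algebraMap (CoordRing k n) (RatFun k n) (X j))
    (algebraMap_ratFun_ne_zero (X_ne_zero i)) hf).trans ?_
  congr 1
  have h3 : aeval (fun j => algebraMap (CoordRing k n) (RatFun k n) (X j)) =
      IsScalarTower.toAlgHom k (CoordRing k n) (RatFun k n) := by
    apply MvPolynomial.algHom_ext
    intro j
    rw [aeval_X]
    rfl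
  rw [h3]
  rfl

theorem isUnit_localRing {z : localRing x} {d : ℕ} {f g : CoordRing k n} (hf : f.IsHomogeneous d)
    (hg : g.IsHomogeneous d) (hf0 : eval x f ≠ 0) (hg0 : eval x g ≠ 0)
    (hz : algebraMap (FunctionField k n) (RatFun k n) z =
      algebraMap (CoordRing k n) (RatFun k n) f / algebraMap (CoordRing k n) (RatFun k n) g) :
    IsUnit z := by
  obtain ⟨w, hw⟩ := exists_localRing_eq_div x hg hf hf0
  refine IsUnit.of_mul_eq_one w (Subtype.ext (algebraMap_functionField_injective ?_))
  have h1 := algebraMap_ratFun_ne_zero (ne_zero_of_eval_ne_zero hf0)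
  have h2 := algebraMap_ratFun_ne_zero (ne_zero_of_eval_ne_zero hg0)
  rw [MulMemClass.coe_mul, map_mul, hz, hw, OneMemClass.coe_one, map_one]
  field_simp

theorem not_isUnit_localRing {z : localRing x} {f g : CoordRing k n}
    (hf0 : eval x f = 0) (hg0 : eval x g ≠ 0)
    (hz : algebraMap (FunctionField k n) (RatFun k n) z =
      algebraMap (CoordRing k n) (RatFun k n) f / algebraMap (CoordRing k n) (RatFun k n) g) :
    ¬ IsUnit z := by
  intro hu
  obtain ⟨w, hw⟩ := hu.exists_right_inv
  obtain ⟨e, f', g', hf', hg', h0', hz'⟩ := mem_localRing_iff.1 w.2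
  have h1 := algebraMap_ratFun_ne_zero (ne_zero_of_eval_ne_zero hg0)
  have h2 := algebraMap_ratFun_ne_zero (ne_zero_of_eval_ne_zero h0')
  have h3 := congrArg (fun a : localRing x => algebraMap (FunctionField k n) (RatFun k n) a) hw
  simp only [MulMemClass.coe_mul, map_mul, hz, hz', OneMemClass.coe_one, map_one] at h3
  rw [div_mul_div_comm, div_eq_one_iff_eq (mul_ne_zero h1 h2), ← map_mul, ← map_mul] at h3
  have h4 := congrArg (eval x) (algebraMap_ratFun_injective h3)
  rw [map_mul, map_mul, hf0, zero_mul] at h4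
  exact mul_ne_zero hg0 h0' h4.symm

/-- The local ring of a point of `ℙⁿ` is a localization of the coordinate ring of an affine
chart. -/
theorem exists_isLocalization_localRing (hi : x i ≠ 0) :
    ∃ φ : MvPolynomial (Fin n) k →ₐ[k] localRing x,
      @IsLocalization.AtPrime _ _ (localRing x) _ φ.toRingHom.toAlgebra
        (vanishingIdeal k {fun j => x (i.succAbove j) / x i}) inferInstance := by
  obtain ⟨φ, hφ⟩ := exists_algHom_localRing hi
  refine ⟨φ, ?_⟩
  let := φ.toRingHom.toAlgebra
  have hmem : ∀ {d : ℕ} {f : CoordRing k n}, f.IsHomogeneous d →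
      (dehomogenize k i f ∈ (vanishingIdeal k {fun j => x (i.succAbove j) / x i}).primeCompl ↔
        eval x f ≠ 0) := fun {d f} hf => by
    rw [Ideal.mem_primeCompl_iff, mem_vanishingIdeal_singleton_iff, aeval_dehomogenize i hi hf,
      aeval_eq_eval, div_eq_zero_iff, not_or]
    exact and_iff_left (pow_ne_zero _ hi)
  have hXi : ∀ d, eval x (X i ^ d) ≠ 0 := fun d => by
    rw [map_pow, eval_X]; exact pow_ne_zero _ hi
  rw [IsLocalization.AtPrime, isLocalization_iff]
  refine ⟨fun ⟨p, hp⟩ => ?_, fun z => ?_, fun {p q} hpq => ⟨1, ?_⟩⟩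
  · obtain ⟨d, f, hf, rfl⟩ := exists_dehomogenize_eq i p
    exact isUnit_localRing hf (isHomogeneous_X_pow i d) ((hmem hf).1 hp) (hXi d) (hφ d f hf)
  · obtain ⟨d, f, g, hf, hg, h0, hz⟩ := mem_localRing_iff.1 z.2
    refine ⟨(dehomogenize k i f, ⟨dehomogenize k i g, (hmem hg).2 h0⟩),
      Subtype.ext (algebraMap_functionField_injective ?_)⟩
    rw [MulMemClass.coe_mul, map_mul, hz]
    refine (congrArg _ (hφ d g hg)).trans (Eq.trans ?_ (hφ d f hf).symm)
    have h1 := algebraMap_ratFun_ne_zero (ne_zero_of_eval_ne_zero h0)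
    field_simp
  · rw [OneMemClass.coe_one, one_mul, one_mul, ← sub_eq_zero]
    obtain ⟨d, f, hf, hfp⟩ := exists_dehomogenize_eq i (p - q)
    have h1 : φ (dehomogenize k i f) = 0 := by
      rw [hfp, map_sub, sub_eq_zero]
      exact hpq
    have h2 := hφ d f hf
    rw [h1, ZeroMemClass.coe_zero, map_zero, eq_comm, div_eq_zero_iff,
      or_iff_left (algebraMap_ratFun_ne_zero (pow_ne_zero d (X_ne_zero i)))] at h2
    rw [← hfp, (map_eq_zero_iff _ algebraMap_ratFun_injective).1 h2, map_zero]

theorem exists_apply_ne_zero (hx : x ≠ 0) : ∃ i, x i ≠ 0 := Function.ne_iff.1 hx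

theorem isLocalRing_localRing (hx : x ≠ 0) : IsLocalRing (localRing x) := by
  obtain ⟨i, hi⟩ := exists_apply_ne_zero hx
  obtain ⟨φ, hφ⟩ := exists_isLocalization_localRing hi
  let := φ.toRingHom.toAlgebra
  exact IsLocalization.AtPrime.isLocalRing _
    (vanishingIdeal k {fun j => x (i.succAbove j) / x i})

theorem isNoetherianRing_localRing (hx : x ≠ 0) : IsNoetherianRing (localRing x) := by
  obtain ⟨i, hi⟩ := exists_apply_ne_zero hx
  obtain ⟨φ, hφ⟩ := exists_isLocalization_localRing hi
  let := φ.toRingHom.toAlgebra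
  exact IsLocalization.isNoetherianRing
    (vanishingIdeal k {fun j => x (i.succAbove j) / x i}).primeCompl _ inferInstance

theorem natCast_le_ringKrullDim_localRing [IsAlgClosed k] (hx : x ≠ 0) :
    (n : WithBot ℕ∞) ≤ ringKrullDim (localRing x) := by
  obtain ⟨i, hi⟩ := exists_apply_ne_zero hx
  obtain ⟨φ, hφ⟩ := exists_isLocalization_localRing hi
  let := φ.toRingHom.toAlgebra
  rw [IsLocalization.AtPrime.ringKrullDim_eq_height
    (vanishingIdeal k {fun j => x (i.succAbove j) / x i}) (localRing x)]
  have h := natCard_le_height_vanishingIdeal_singleton fun j => x (i.succAbove j) / x i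
  rw [Nat.card_eq_fintype_card, Fintype.card_fin] at h
  exact_mod_cast h

end Affine

end

/-! ### Rational forms in homogeneous coordinates, and contractions. -/

noncomputable section

universe u

variable {k : Type u} [Field k] {n : ℕ}

theorem ratFun_derivation_ext {M : Type*} [AddCommGroup M] [Module k M] [Module (RatFun k n) M]
    [IsScalarTower k (RatFun k n) M] {d₁ d₂ : Derivation k (RatFun k n) M}
    (h : ∀ i, d₁ (algebraMap (CoordRing k n) (RatFun k n) (X i)) =
      d₂ (algebraMap (CoordRing k n) (RatFun k n) (X i))) : d₁ = d₂ := by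
  let : Module (CoordRing k n) M := Module.compHom M (algebraMap (CoordRing k n) (RatFun k n))
  have : IsScalarTower (CoordRing k n) (RatFun k n) M := ⟨fun a b c => by
    rw [Algebra.smul_def, mul_smul]; rfl⟩
  have : IsScalarTower k (CoordRing k n) M := ⟨fun a b c => by
    rw [← algebraMap_smul (RatFun k n) (a • b) c, ← algebraMap_smul (RatFun k n) b c,
      Algebra.smul_def, map_mul, mul_smul, ← IsScalarTower.algebraMap_apply, algebraMap_smul]⟩
  have h0 : ∀ f : CoordRing k n, d₁ (algebraMap _ _ f) = d₂ (algebraMap _ _ f) := by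
    have h1 : d₁.compAlgebraMap (CoordRing k n) = d₂.compAlgebraMap (CoordRing k n) :=
      MvPolynomial.derivation_ext h
    exact fun f => congrArg (fun d => d f) h1
  ext z
  obtain ⟨a, b, hb, rfl⟩ := IsFractionRing.div_surjective (A := CoordRing k n) z
  rw [Derivation.leibniz_div, Derivation.leibniz_div, h0, h0]

/-- On exact forms both sides are derivations in the function, and they agree on the variables. -/
theorem eq_sum_lift_ratPderiv_smul (α : Ω[RatFun k n⁄k]) :
    α = ∑ j, (ratPderiv k n j).liftKaehlerDifferential α •
      D k (RatFun k n) (algebraMap (CoordRing k n) (RatFun k n) (X j)) := by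
  have happ : ∀ z, (∑ j, ((LinearMap.toSpanSingleton (RatFun k n) (Ω[RatFun k n⁄k])
      (D k (RatFun k n) (algebraMap (CoordRing k n) (RatFun k n) (X j)))).compDer
        (ratPderiv k n j))) z = ∑ j, ratPderiv k n j z •
      D k (RatFun k n) (algebraMap (CoordRing k n) (RatFun k n) (X j)) := fun z => by
    refine (congrFun (map_sum (Derivation.coeFnAddMonoidHom (R := k) (A := RatFun k n)
      (M := Ω[RatFun k n⁄k])) _ Finset.univ) z).trans ?_
    rw [Finset.sum_apply]
    rfl
  have h : D k (RatFun k n) = ∑ j, ((LinearMap.toSpanSingleton (RatFun k n) (Ω[RatFun k n⁄k])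
      (D k (RatFun k n) (algebraMap (CoordRing k n) (RatFun k n) (X j)))).compDer
        (ratPderiv k n j)) := by
    apply ratFun_derivation_ext
    intro i
    rw [happ, Finset.sum_eq_single i]
    · rw [ratPderiv_algebraMap, pderiv_X_self, map_one, one_smul]
    · intro j _ hj
      rw [ratPderiv_algebraMap, pderiv_X_of_ne hj.symm, map_zero, zero_smul]
    · simp
  have hα : α ∈ Submodule.span (RatFun k n) (Set.range (D k (RatFun k n))) := by
    rw [span_range_derivation]; trivial
  induction hα using Submodule.span_induction with
  | zero => simp
  | add a b _ _ ha hb =>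
    conv_lhs => rw [ha, hb]
    rw [← Finset.sum_add_distrib]
    exact Finset.sum_congr rfl fun j _ => by rw [map_add, add_smul]
  | smul r a _ ha =>
    conv_lhs => rw [ha]
    rw [Finset.smul_sum]
    exact Finset.sum_congr rfl fun j _ => by rw [map_smul, smul_eq_mul, mul_smul]
  | mem a ha =>
    obtain ⟨z, rfl⟩ := ha
    refine (congrArg (fun d : Derivation k (RatFun k n) (Ω[RatFun k n⁄k]) => d z) h).trans
      ((happ z).trans (Finset.sum_congr rfl fun j _ => ?_))
    rw [Derivation.liftKaehlerDifferential_comp_D]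

/-- The coefficient of `dxⱼ` of a rational 1-form in homogeneous coordinates. -/
def ratCoeff (ω : RatForm k n) (j : Fin (n + 1)) : RatFun k n :=
  (ratPderiv k n j).liftKaehlerDifferential (inHomogeneousCoords k n ω)

theorem inHomogeneousCoords_eq_sum (ω : RatForm k n) : inHomogeneousCoords k n ω =
    ∑ j, ratCoeff ω j • D k (RatFun k n) (algebraMap (CoordRing k n) (RatFun k n) (X j)) :=
  eq_sum_lift_ratPderiv_smul _

theorem ratForm_induction {p : RatForm k n → Prop} (zero : p 0)
    (add : ∀ α β, p α → p β → p (α + β))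
    (smul_D : ∀ a b : FunctionField k n, p (a • D k (FunctionField k n) b)) (α : RatForm k n) :
    p α := by
  have hα : α ∈ Submodule.span (FunctionField k n) (Set.range (D k (FunctionField k n))) := by
    rw [span_range_derivation]; trivial
  induction hα using Submodule.closure_induction with
  | zero => exact zero
  | add x y _ _ hx hy => exact add x y hx hy
  | smul_mem r x h =>
    obtain ⟨b, rfl⟩ := h
    exact smul_D r b

theorem ratCoeff_add (α β : RatForm k n) (j : Fin (n + 1)) :
    ratCoeff (α + β) j = ratCoeff α j + ratCoeff β j := by
  rw [ratCoeff, map_add, map_add]; rfl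

theorem ratCoeff_smul_D (a b : FunctionField k n) (j : Fin (n + 1)) :
    ratCoeff (a • D k (FunctionField k n) b) j =
      algebraMap (FunctionField k n) (RatFun k n) a *
        ratPderiv k n j (algebraMap (FunctionField k n) (RatFun k n) b) := by
  rw [ratCoeff, map_smul, inHomogeneousCoords, map_D, ← algebraMap_smul (RatFun k n) a, map_smul,
    Derivation.liftKaehlerDifferential_comp_D, smul_eq_mul]

theorem ratCoeff_zero (j : Fin (n + 1)) : ratCoeff (0 : RatForm k n) j = 0 := by
  rw [ratCoeff, map_zero, map_zero]

theorem algebraMap_lift_eulerDerivation (i j : Fin (n + 1)) (ω : RatForm k n) :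
    algebraMap (FunctionField k n) (RatFun k n)
      ((eulerDerivation k n i j).liftKaehlerDifferential ω) =
      algebraMap (CoordRing k n) (RatFun k n) (X i) * ratCoeff ω j := by
  induction ω using ratForm_induction with
  | zero => rw [map_zero, map_zero, ratCoeff_zero, mul_zero]
  | add α β hα hβ => rw [map_add, map_add, hα, hβ, ratCoeff_add, mul_add]
  | smul_D a b =>
    rw [map_smul, Derivation.liftKaehlerDifferential_comp_D, smul_eq_mul, map_mul,
      algebraMap_eulerDerivation, ratCoeff_smul_D]
    ring

/-- A form from projective space is killed by contraction with the Euler field, because the Euler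
field kills quotients of forms of equal degree. -/
theorem sum_X_mul_ratCoeff (ω : RatForm k n) :
    ∑ j, algebraMap (CoordRing k n) (RatFun k n) (X j) * ratCoeff ω j = 0 := by
  induction ω using ratForm_induction with
  | zero => simp [ratCoeff_zero]
  | add α β hα hβ =>
    simp only [ratCoeff_add, mul_add, Finset.sum_add_distrib, hα, hβ, add_zero]
  | smul_D a b =>
    obtain ⟨d, f, g, hf, hg, h0, e⟩ := exists_div_eq_algebraMap b
    have h1 : ∀ j, algebraMap (CoordRing k n) (RatFun k n) (X j) *
        ratCoeff (a • D k (FunctionField k n) b) j =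
        algebraMap (FunctionField k n) (RatFun k n) a *
          (algebraMap (CoordRing k n) (RatFun k n)
            (g * (X j * pderiv j f) - f * (X j * pderiv j g)) /
            algebraMap (CoordRing k n) (RatFun k n) (g * g)) := fun j => by
      rw [ratCoeff_smul_D, mul_left_comm, e, X_mul_ratPderiv_div _ _ h0]
    simp only [h1]
    rw [← Finset.mul_sum, ← Finset.sum_div, ← map_sum, Finset.sum_sub_distrib, ← Finset.mul_sum,
      ← Finset.mul_sum, hf.sum_X_mul_pderiv, hg.sum_X_mul_pderiv]
    have h2 : g * d • f - f * d • g = 0 := by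
      rw [mul_smul_comm, mul_smul_comm, mul_comm, sub_self]
    rw [h2, map_zero, zero_div, mul_zero]

section Contraction

variable {K : Type*} [Field K] [Algebra k K]

/-- The contraction of 2-forms with a pair of derivations. -/
def contractTwo (δ δ' : Derivation k K K) : TwoForms k K →ₗ[K] K :=
  exteriorPower.alternatingMapLinearEquiv ((Matrix.detRowAlternating (n := Fin 2)).compLinearMap
    (LinearMap.pi ![δ.liftKaehlerDifferential, δ'.liftKaehlerDifferential]))

theorem contractTwo_wedge (δ δ' : Derivation k K K) (α β : Ω[K⁄k]) :
    contractTwo δ δ' (wedge α β) =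
      δ.liftKaehlerDifferential α * δ'.liftKaehlerDifferential β -
        δ'.liftKaehlerDifferential α * δ.liftKaehlerDifferential β := by
  rw [contractTwo, wedge, exteriorPower.alternatingMapLinearEquiv_apply_ιMulti]
  exact Matrix.det_fin_two _

/-- Cartan's formula for dω; the bracket term is absent because the derivations commute. -/
theorem contractTwo_extDeriv {δ δ' : Derivation k (FunctionField k n) (FunctionField k n)}
    (hδ : ∀ z, δ (δ' z) = δ' (δ z)) (ω : RatForm k n) :
    contractTwo δ δ' (extDeriv ω) =
      δ (δ'.liftKaehlerDifferential ω) - δ' (δ.liftKaehlerDifferential ω) := by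
  induction ω using ratForm_induction with
  | zero => simp
  | add α β hα hβ => simp only [map_add, hα, hβ]; ring
  | smul_D a b =>
    rw [extDeriv_smul_D, contractTwo_wedge]
    simp only [map_smul, Derivation.liftKaehlerDifferential_comp_D, smul_eq_mul,
      Derivation.leibniz, hδ]
    ring

end Contraction

section Regular

variable {x : Fin (n + 1) → k}

theorem lift_mem_localRing_of_mem_regularOneForms
    {δ : Derivation k (FunctionField k n) (FunctionField k n)}
    (hδ : ∀ z ∈ localRing x, δ z ∈ localRing x) {α : RatForm k n} (hα : α ∈ regularOneForms x) :
    δ.liftKaehlerDifferential α ∈ localRing x := by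
  induction hα using Submodule.span_induction with
  | zero => rw [map_zero]; exact zero_mem _
  | add a b _ _ ha hb => rw [map_add]; exact add_mem ha hb
  | smul r a _ ha =>
    rw [Subalgebra.smul_def, map_smul]
    exact mul_mem r.2 ha
  | mem a ha =>
    obtain ⟨b, rfl⟩ := ha
    rw [Derivation.liftKaehlerDifferential_comp_D]
    exact hδ _ b.2

theorem contractTwo_mem_localRing_of_mem_regularTwoForms
    {δ δ' : Derivation k (FunctionField k n) (FunctionField k n)}
    (hδ : ∀ z ∈ localRing x, δ z ∈ localRing x) (hδ' : ∀ z ∈ localRing x, δ' z ∈ localRing x)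
    {α : TwoForms k (FunctionField k n)} (hα : α ∈ regularTwoForms x) :
    contractTwo δ δ' α ∈ localRing x := by
  induction hα using Submodule.span_induction with
  | zero => rw [map_zero]; exact zero_mem _
  | add a b _ _ ha hb => rw [map_add]; exact add_mem ha hb
  | smul r a _ ha =>
    rw [Subalgebra.smul_def, map_smul]
    exact mul_mem r.2 ha
  | mem a ha =>
    obtain ⟨b, c, rfl⟩ := ha
    rw [contractTwo_wedge]
    simp only [Derivation.liftKaehlerDifferential_comp_D]
    exact sub_mem (mul_mem (hδ _ b.2) (hδ' _ c.2)) (mul_mem (hδ' _ b.2) (hδ _ c.2))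

end Regular

end

/-! ### The polynomial coefficients of a logarithmic form. -/

noncomputable section

universe u

variable {k : Type u} [Field k] {n : ℕ}

local notation "ι" => algebraMap (CoordRing k n) (RatFun k n)
local notation "ε" => algebraMap (FunctionField k n) (RatFun k n)

variable {F : CoordRing k n} {ω : RatForm k n} {x : Fin (n + 1) → k}

/-- `IsLogForm` provides one local equation at each point; this transfers its conditions to any
other. -/
theorem IsLocalEquation.exists_eq_mul {a b : localRing x} (ha : IsLocalEquation F x a)
    (hb : IsLocalEquation F x b) : ∃ w : localRing x, b = w * a := by
  obtain ⟨d, q, v, hF, hq, h0, ha⟩ := ha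
  obtain ⟨d', q', v', hF', hq', h0', hb⟩ := hb
  by_cases hF0 : F = 0
  · subst hF0
    refine ⟨0, Subtype.ext (algebraMap_functionField_injective ?_)⟩
    rw [hb, zero_mul, ZeroMemClass.coe_zero, map_zero, map_zero, zero_div, mul_zero]
  · obtain rfl := hF.inj_right hF' hF0
    obtain ⟨w, hw⟩ := exists_localRing_eq_div x hq hq' h0'
    refine ⟨v' * ↑v⁻¹ * w, Subtype.ext (algebraMap_functionField_injective ?_)⟩
    have hv : ε (v⁻¹ : (localRing x)ˣ).1 * ε v.1 = 1 := by
      rw [← map_mul, ← MulMemClass.coe_mul, Units.inv_mul, OneMemClass.coe_one, map_one]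
    have h1 := algebraMap_ratFun_ne_zero (ne_zero_of_eval_ne_zero h0)
    have h1' := algebraMap_ratFun_ne_zero (ne_zero_of_eval_ne_zero h0')
    rw [hb, MulMemClass.coe_mul, MulMemClass.coe_mul, MulMemClass.coe_mul, map_mul, map_mul,
      map_mul, hw, ha]
    field_simp
    rw [mul_assoc, hv, mul_one]

theorem isLocalEquation_of_eq_div {d : ℕ} {q : CoordRing k n} (hF : F.IsHomogeneous d)
    (hq : q.IsHomogeneous d) (h0 : eval x q ≠ 0) {a : localRing x} (ha : ε a = ι F / ι q) :
    IsLocalEquation F x a :=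
  ⟨d, q, 1, hF, hq, h0, by rw [ha, Units.val_one, OneMemClass.coe_one, map_one, one_mul]⟩

theorem IsLogForm.mul_lift_mem (hω : IsLogForm F ω) (hx : x ≠ 0) {a : localRing x}
    (ha : IsLocalEquation F x a) (i j : Fin (n + 1)) :
    (a : FunctionField k n) * (eulerDerivation k n i j).liftKaehlerDifferential ω ∈
      localRing x := by
  obtain ⟨b, hb, h1, -⟩ := hω x hx
  obtain ⟨w, rfl⟩ := hb.exists_eq_mul ha
  have h2 := lift_mem_localRing_of_mem_regularOneForms
    (fun z hz => eulerDerivation_mem_localRing i j hz) h1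
  rw [map_smul, smul_eq_mul] at h2
  rw [MulMemClass.coe_mul, mul_assoc]
  exact mul_mem w.2 h2

theorem IsLogForm.mul_sub_mem (hω : IsLogForm F ω) (hx : x ≠ 0) {a : localRing x}
    (ha : IsLocalEquation F x a) {i j l : Fin (n + 1)} (hj : j ≠ i) (hl : l ≠ i) :
    (a : FunctionField k n) *
      (eulerDerivation k n i j ((eulerDerivation k n i l).liftKaehlerDifferential ω) -
        eulerDerivation k n i l ((eulerDerivation k n i j).liftKaehlerDifferential ω)) ∈
      localRing x := by
  obtain ⟨b, hb, -, h1⟩ := hω x hx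
  obtain ⟨w, rfl⟩ := hb.exists_eq_mul ha
  have h2 := contractTwo_mem_localRing_of_mem_regularTwoForms
    (fun z hz => eulerDerivation_mem_localRing i j hz)
    (fun z hz => eulerDerivation_mem_localRing i l hz) h1
  rw [map_smul, smul_eq_mul, contractTwo_extDeriv (eulerDerivation_comm hj hl)] at h2
  rw [MulMemClass.coe_mul, mul_assoc]
  exact mul_mem w.2 h2

/-- A rational function regular on affine space minus the origin is a polynomial: an irreducible
factor of its reduced denominator would vanish at a nonzero point. -/
theorem eq_algebraMap_of_forall_exists_mul [IsAlgClosed k] (hn : n ≠ 0) {z : RatFun k n}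
    (hz : ∀ x : Fin (n + 1) → k, x ≠ 0 → ∃ s p : CoordRing k n, eval x s ≠ 0 ∧ ι s * z = ι p) :
    ∃ p, z = ι p := by
  have hnd := IsFractionRing.mk'_num_den' (CoordRing k n) z
  have hd0 : ι (IsFractionRing.den (CoordRing k n) z : CoordRing k n) ≠ 0 :=
    algebraMap_ratFun_ne_zero (nonZeroDivisors.ne_zero (IsFractionRing.den (CoordRing k n) z).2)
  have hu : IsUnit (IsFractionRing.den (CoordRing k n) z : CoordRing k n) := by
    by_contra hu
    obtain ⟨p, hp, hpd⟩ := WfDvdMonoid.exists_irreducible_factor hu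
      (nonZeroDivisors.ne_zero (IsFractionRing.den (CoordRing k n) z).2)
    obtain ⟨x, hx, hxp⟩ := exists_ne_zero_eval_eq_zero hn hp
    obtain ⟨s, p', hs, e⟩ := hz x hx
    have h1 : s * IsFractionRing.num (CoordRing k n) z =
        p' * IsFractionRing.den (CoordRing k n) z := by
      apply algebraMap_ratFun_injective
      rw [map_mul, map_mul, ← e, ← div_eq_iff hd0, mul_div_assoc, hnd]
    have h2 : (IsFractionRing.den (CoordRing k n) z : CoordRing k n) ∣ s :=
      (IsFractionRing.num_den_reduced (CoordRing k n) z).symm.dvd_of_dvd_mul_right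
        ⟨p', by rw [h1, mul_comm]⟩
    obtain ⟨c, rfl⟩ := hpd.trans h2
    rw [map_mul, hxp, zero_mul] at hs
    exact hs rfl
  obtain ⟨u, hu⟩ := hu
  refine ⟨IsFractionRing.num (CoordRing k n) z * ↑u⁻¹, ?_⟩
  rw [div_eq_iff hd0] at hnd
  rw [map_mul, hnd, ← hu, mul_assoc, ← map_mul, Units.mul_inv, map_one, mul_one]

theorem IsLogForm.exists_mul_ratCoeff_eq [IsAlgClosed k] (hω : IsLogForm F ω) {d : ℕ}
    (hF : F.IsHomogeneous d) (hn : n ≠ 0) (j : Fin (n + 1)) :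
    ∃ A : CoordRing k n, ι F * ratCoeff ω j = ι A := by
  refine eq_algebraMap_of_forall_exists_mul hn fun x hx => ?_
  obtain ⟨i, hi⟩ := exists_apply_ne_zero hx
  have hXi : eval x (X i ^ d) ≠ 0 := by
    rw [map_pow, eval_X]; exact pow_ne_zero _ hi
  obtain ⟨a, ha⟩ := exists_localRing_eq_div x hF (isHomogeneous_X_pow i d) hXi
  obtain ⟨e, f, g, hf, hg, h0, h⟩ := mem_localRing_iff.1 (hω.mul_lift_mem hx
    (isLocalEquation_of_eq_div hF (isHomogeneous_X_pow i d) hXi ha) i j)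
  refine ⟨g * X i, f * X i ^ d, by rw [map_mul, eval_X]; exact mul_ne_zero h0 hi, ?_⟩
  have h1 := algebraMap_ratFun_ne_zero (ne_zero_of_eval_ne_zero hXi)
  have h2 := algebraMap_ratFun_ne_zero (ne_zero_of_eval_ne_zero h0)
  rw [map_mul, ha, algebraMap_lift_eulerDerivation] at h
  field_simp at h
  rw [map_mul, map_mul]
  linear_combination h

section Coefficients

variable {A : Fin (n + 1) → CoordRing k n} {d : ℕ}

theorem sum_X_mul_eq_zero (hA : ∀ j, ι F * ratCoeff ω j = ι (A j)) :
    ∑ j, X j * A j = 0 := by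
  apply algebraMap_ratFun_injective
  have h := congrArg (ι F * ·) (sum_X_mul_ratCoeff ω)
  simp only [Finset.mul_sum, mul_zero] at h
  rw [map_zero, map_sum, ← h]
  exact Finset.sum_congr rfl fun j _ => by rw [map_mul, ← hA]; ring

/-- X i * A j is F times an element of the function field. The factor X i avoids the degree d - 1.
-/
theorem isHomogeneous_X_mul (hA : ∀ j, ι F * ratCoeff ω j = ι (A j))
    (hF : F.IsHomogeneous d) (i j : Fin (n + 1)) : (X i * A j).IsHomogeneous d := by
  obtain ⟨e, f, g, hf, hg, h0, h⟩ :=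
    exists_div_eq_algebraMap ((eulerDerivation k n i j).liftKaehlerDifferential ω)
  refine .of_mul_right hg h0 ?_
  have h1 : X i * A j * g = F * f := by
    apply algebraMap_ratFun_injective
    have h2 := algebraMap_ratFun_ne_zero h0
    rw [algebraMap_lift_eulerDerivation, eq_div_iff h2] at h
    rw [map_mul, map_mul, map_mul, ← hA, ← h]
    ring
  rw [h1]
  exact hF.mul hf

theorem isHomogeneous_of_add_one (hA : ∀ j, ι F * ratCoeff ω j = ι (A j))
    (hF : F.IsHomogeneous d) {e : ℕ} (he : e + 1 = d) (j : Fin (n + 1)) :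
    (A j).IsHomogeneous e := by
  refine .of_mul_right (isHomogeneous_X k 0) (X_ne_zero 0) ?_
  rw [he, mul_comm]
  exact isHomogeneous_X_mul hA hF 0 j

/-- These are the coefficients of dF ∧ Fω = F d(Fω) - F² dω, and F dω is regular at x. This gives
divisibility by h up to factors that do not vanish at x, and the prime h, which vanishes there,
divides none of those. -/
theorem dvd_mul_pderiv_sub_of_eval_eq_zero (hA : ∀ j, ι F * ratCoeff ω j = ι (A j))
    (hF : F.IsHomogeneous d) (hω : IsLogForm F ω) (hF0 : F ≠ 0) {h : CoordRing k n}
    (hh : Prime h) (hhF : h ∣ F) (hx : x ≠ 0) (hxh : eval x h = 0) (j l : Fin (n + 1)) :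
    h ∣ A l * pderiv j F - A j * pderiv l F := by
  obtain ⟨i, hi⟩ := exists_apply_ne_zero hx
  have hndvd : ∀ g : CoordRing k n, eval x g ≠ 0 → ¬ h ∣ g := by
    rintro _ hg ⟨c, rfl⟩
    rw [map_mul, hxh, zero_mul] at hg
    exact hg rfl
  have hXi : eval x (X i ^ d) ≠ 0 := by
    rw [map_pow, eval_X]; exact pow_ne_zero _ hi
  have hndX : ¬ h ∣ X i := hndvd _ (by rwa [eval_X])
  have key : ∀ {j l}, j ≠ i → l ≠ i → h ∣ A l * pderiv j F - A j * pderiv l F := by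
    intro j l hj hl
    obtain ⟨a, ha⟩ := exists_localRing_eq_div x hF (isHomogeneous_X_pow i d) hXi
    obtain ⟨e, f, g, hf, hg, h0, hm⟩ := mem_localRing_iff.1 (hω.mul_sub_mem hx
      (isLocalEquation_of_eq_div hF (isHomogeneous_X_pow i d) hXi ha) hj hl)
    have hF0' := algebraMap_ratFun_ne_zero hF0
    have hρ : ∀ j, ratCoeff ω j = ι (A j) / ι F := fun j => by
      rw [← hA, mul_div_cancel_left₀ _ hF0']
    have h1 := algebraMap_ratFun_ne_zero (ne_zero_of_eval_ne_zero hXi)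
    have h2 := algebraMap_ratFun_ne_zero (ne_zero_of_eval_ne_zero h0)
    rw [map_mul, map_sub, ha] at hm
    simp only [algebraMap_eulerDerivation, algebraMap_lift_eulerDerivation, Derivation.leibniz,
      ratPderiv_algebraMap, pderiv_X_of_ne hj.symm, pderiv_X_of_ne hl.symm, map_zero, smul_eq_mul,
      mul_zero, add_zero, hρ, ratPderiv_div _ _ hF0, map_mul, map_sub] at hm
    have h3 : ι (g * X i ^ 2 * (A l * pderiv j F - A j * pderiv l F)) =
        ι (F * (g * X i ^ 2 * (pderiv j (A l) - pderiv l (A j)) - f * X i ^ d)) := by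
      simp only [map_mul, map_sub, map_pow] at hm h1 ⊢
      field_simp at hm
      linear_combination -hm
    have h4 : h ∣ g * X i ^ 2 * (A l * pderiv j F - A j * pderiv l F) := by
      rw [algebraMap_ratFun_injective h3]
      exact hhF.mul_right _
    refine (hh.dvd_or_dvd h4).resolve_left (hndvd _ ?_)
    rw [map_mul, map_pow, eval_X]
    exact mul_ne_zero h0 (pow_ne_zero _ hi)
  -- The index i is not covered by the chart xᵢ ≠ 0. It follows from the other indices, since the
  -- sum over j weighted by X j is d F A l by Euler's identity.
  have key' : ∀ {l}, l ≠ i → h ∣ A l * pderiv i F - A i * pderiv l F := by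
    intro l hl
    refine (hh.dvd_or_dvd (a := X i) ?_).resolve_left hndX
    have h1 : ∑ j, X j * (A l * pderiv j F - A j * pderiv l F) = d • F * A l := by
      have h2 : ∑ j, X j * (A l * pderiv j F - A j * pderiv l F) =
          (∑ j, X j * pderiv j F) * A l - (∑ j, X j * A j) * pderiv l F := by
        rw [Finset.sum_mul, Finset.sum_mul, ← Finset.sum_sub_distrib]
        exact Finset.sum_congr rfl fun j _ => by ring
      rw [h2, sum_X_mul_eq_zero hA, zero_mul, sub_zero, hF.sum_X_mul_pderiv]
    rw [Finset.sum_eq_add_sum_sdiff_singleton_of_mem (Finset.mem_univ i)] at h1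
    rw [eq_sub_of_add_eq h1]
    refine dvd_sub ((hhF.trans ⟨d, by rw [nsmul_eq_mul, mul_comm]⟩).mul_right _)
      (Finset.dvd_sum fun j hj => (key ?_ hl).mul_left _)
    simpa using hj
  by_cases hj : j = i
  · subst hj
    by_cases hl : l = j
    · subst hl; simp
    · exact key' hl
  · by_cases hl : l = i
    · subst hl
      have := key' hj
      rw [← dvd_neg]
      convert this using 1
      ring
    · exact key hj hl

end Coefficients

end

/-! ### The integral equation of the residue at a normal crossing point. -/

noncomputable section

universe u

variable {k : Type u} [Field k] {n : ℕ}

local notation "ι" => algebraMap (CoordRing k n) (RatFun k n)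
local notation "ε" => algebraMap (FunctionField k n) (RatFun k n)

variable {ω : RatForm k n} {x : Fin (n + 1) → k}

/-- Denominators are cleared; all of them are nonzero at x, and s is built from them. -/
theorem exists_mul_mem_integralRelationIdeal {h P Q : CoordRing k n} {d e : ℕ} {i : Fin (n + 1)}
    (hi : x i ≠ 0) {t P' Q' : localRing x} (ht : ε t = ι h / ι (X i ^ d))
    (hP' : ε P' = ι P / ι (X i ^ e)) (hQ' : ε Q' = ι Q / ι (X i ^ e)) {m : ℕ}
    (hmem : P' ^ m ∈ integralRelationIdeal t P' Q' m) :
    ∃ s, eval x s ≠ 0 ∧ s * P ^ m ∈ integralRelationIdeal h P Q m := by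
  have hXi : ∀ d, eval x (X i ^ d) ≠ 0 := fun d => by
    rw [map_pow, eval_X]; exact pow_ne_zero _ hi
  have hX : ∀ d, ι (X i ^ d) ≠ 0 := fun d =>
    algebraMap_ratFun_ne_zero (ne_zero_of_eval_ne_zero (hXi d))
  have claim : ∀ c ∈ integralRelationIdeal t P' Q' m, ∃ s, eval x s ≠ 0 ∧
      ∃ w ∈ integralRelationIdeal h P Q m, ι s * ε c = ι w := by
    intro c hc
    induction hc using Submodule.span_induction with
    | zero => exact ⟨1, by simp, 0, zero_mem _, by simp⟩
    | add a b _ _ ha hb =>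
      obtain ⟨s, hs, w, hw, e⟩ := ha
      obtain ⟨s', hs', w', hw', e'⟩ := hb
      refine ⟨s * s', by rw [map_mul]; exact mul_ne_zero hs hs', s' * w + s * w',
        add_mem (Ideal.mul_mem_left _ _ hw) (Ideal.mul_mem_left _ _ hw'), ?_⟩
      rw [AddMemClass.coe_add, map_add, map_add, map_mul, map_mul, map_mul, ← e, ← e']
      ring
    | smul r a _ ha =>
      obtain ⟨s, hs, w, hw, e⟩ := ha
      obtain ⟨_, f, g, _, _, h0, hr⟩ := mem_localRing_iff.1 r.2
      refine ⟨s * g, by rw [map_mul]; exact mul_ne_zero hs h0, f * w,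
        Ideal.mul_mem_left _ _ hw, ?_⟩
      have h1 := algebraMap_ratFun_ne_zero (ne_zero_of_eval_ne_zero h0)
      rw [smul_eq_mul, MulMemClass.coe_mul, map_mul, map_mul, map_mul, ← e, hr]
      field_simp
    | mem a ha =>
      obtain rfl | ⟨j, hj, rfl⟩ := ha
      · exact ⟨X i ^ d, hXi d, h, Ideal.subset_span (Or.inl rfl), by
          rw [ht, mul_div_cancel₀ _ (hX d)]⟩
      · refine ⟨(X i ^ e) ^ m, by rw [map_pow]; exact pow_ne_zero _ (hXi e), Q ^ (m - j) * P ^ j,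
          Ideal.subset_span (Or.inr ⟨j, hj, rfl⟩), ?_⟩
        have h1 : m = (m - j) + j := (Nat.sub_add_cancel (le_of_lt hj)).symm
        have h2 := hX e
        simp only [MulMemClass.coe_mul, SubmonoidClass.coe_pow, map_mul, map_pow ι, map_pow ε, hP',
          hQ', div_pow] at h2 ⊢
        conv_lhs => rw [h1, pow_add]
        rw [← h1]
        field_simp
  obtain ⟨s, hs, w, hw, e1⟩ := claim _ hmem
  refine ⟨s, hs, ?_⟩
  have h1 : s * P ^ m = (X i ^ e) ^ m * w := by
    apply algebraMap_ratFun_injective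
    have h2 := hX e
    rw [map_mul, map_mul, ← e1, SubmonoidClass.coe_pow, map_pow, map_pow ε, map_pow, hP', div_pow]
    field_simp
  rw [h1]
  exact Ideal.mul_mem_left _ _ hw

/-- The étale-local result is applied to the local ring at x, with the affine coordinates centred at
x and the derivations xᵢ ∂/∂xⱼ dual to them. The coefficients E are the contractions of aω. -/
theorem IsNormalCrossingAt.exists_mul_pow_mem [IsAlgClosed k] {h G : CoordRing k n}
    (hNC : IsNormalCrossingAt (h * G) x) (hx : x ≠ 0) (hω : IsLogForm (h * G) ω)
    {A : Fin (n + 1) → CoordRing k n} (hA : ∀ j, ι (h * G) * ratCoeff ω j = ι (A j)) {d dh e : ℕ}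
    (hh : h.IsHomogeneous dh) (hF : (h * G).IsHomogeneous d) (hF0 : h * G ≠ 0) {P Q : CoordRing k n} (hP : P.IsHomogeneous e) (hQ : Q.IsHomogeneous e)
    (hPQ : ∀ j, h ∣ Q * A j - P * (G * pderiv j h)) :
    ∃ s, eval x s ≠ 0 ∧ ∃ m, s * P ^ m ∈ integralRelationIdeal h P Q m := by
  obtain ⟨i, hi⟩ := exists_apply_ne_zero hx
  obtain ⟨a, ha, B, _, _, _, q, _, hq, z, hz, J, hf⟩ := hNC
  obtain ⟨d', p, v, hF', hp, hp0, hap⟩ := id ha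
  obtain rfl := hF.inj_right hF' hF0
  have := isLocalRing_localRing hx
  have := isNoetherianRing_localRing hx
  have hXi : ∀ d, eval x (X i ^ d) ≠ 0 := fun d => by
    rw [map_pow, eval_X]; exact pow_ne_zero _ hi
  have hX : ι (X i) ≠ 0 := algebraMap_ratFun_ne_zero (X_ne_zero i)
  have hp' := algebraMap_ratFun_ne_zero (ne_zero_of_eval_ne_zero hp0)
  have hh0 : h ≠ 0 := left_ne_zero_of_mul hF0
  have hF0' := algebraMap_ratFun_ne_zero hF0
  -- The given local equation has its own denominator p of degree d. With t = h / xᵢ^dh, the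
  -- cofactor G xᵢ^dh / p makes t * g equal to F / p.
  have hGX : (G * X i ^ dh).IsHomogeneous d := by
    refine .of_mul_right hh hh0 ?_
    have : G * X i ^ dh * h = h * G * X i ^ dh := by ring
    rw [this]
    exact hF.mul (isHomogeneous_X_pow i dh)
  obtain ⟨t, ht⟩ := exists_localRing_eq_div x hh (isHomogeneous_X_pow i dh) (hXi dh)
  obtain ⟨g, hg⟩ := exists_localRing_eq_div x hGX hp hp0
  obtain ⟨P', hP'⟩ := exists_localRing_eq_div x hP (isHomogeneous_X_pow i e) (hXi e)
  obtain ⟨Q', hQ'⟩ := exists_localRing_eq_div x hQ (isHomogeneous_X_pow i e) (hXi e)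
  have hatg : a = t * (v * g) := Subtype.ext (algebraMap_functionField_injective (by
    rw [MulMemClass.coe_mul, MulMemClass.coe_mul, map_mul, map_mul, hap, ht, hg]
    simp only [map_mul, map_pow]
    field_simp))
  have hy : ∀ j : Fin n, ∃ y : localRing x, ε y =
      ι (X (i.succAbove j)) / ι (X i) - algebraMap k (RatFun k n) (x (i.succAbove j) / x i) ∧
      y ∈ IsLocalRing.maximalIdeal (localRing x) := by
    intro j
    have h1 : ι (X (i.succAbove j) - C (x (i.succAbove j) / x i) * X i) / ι (X i) =
        ι (X (i.succAbove j)) / ι (X i) - algebraMap k (RatFun k n) (x (i.succAbove j) / x i) := by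
      rw [map_sub, map_mul, sub_div, mul_div_cancel_right₀ _ hX,
        IsScalarTower.algebraMap_apply k (CoordRing k n) (RatFun k n)]
      rfl
    have h2 : (X (i.succAbove j) - C (x (i.succAbove j) / x i) * X i :
        CoordRing k n).IsHomogeneous 1 :=
      (isHomogeneous_X k _).sub (isHomogeneous_C_mul_X _ _)
    have h3 : eval x (X i) ≠ 0 := by rwa [eval_X]
    obtain ⟨y, hy⟩ := exists_localRing_eq_div x h2 (isHomogeneous_X k i) h3
    refine ⟨y, hy.trans h1, (IsLocalRing.mem_maximalIdeal _).2
      (not_isUnit_localRing (by simp [hi]) h3 hy)⟩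
  choose y hy hym using hy
  have hsa : ∀ j, i.succAbove j ≠ i := fun j => Fin.succAbove_ne i j
  have hδ : ∀ j l, localEulerDerivation x i (i.succAbove j) (y l) = if j = l then 1 else 0 := by
    intro j l
    apply Subtype.ext
    apply algebraMap_functionField_injective
    rw [coe_localEulerDerivation, algebraMap_eulerDerivation, hy, map_sub,
      Derivation.map_algebraMap, sub_zero, X_mul_ratPderiv_div _ _ (X_ne_zero i),
      pderiv_X_of_ne (hsa j).symm, mul_zero, mul_zero, sub_zero]
    split_ifs with hjl
    · subst hjl
      rw [pderiv_X_self, mul_one, div_self (algebraMap_ratFun_ne_zero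
        (mul_ne_zero (X_ne_zero i) (X_ne_zero i))), OneMemClass.coe_one, map_one]
    · rw [pderiv_X_of_ne (fun h => hjl (Fin.succAbove_right_injective h.symm)), mul_zero, mul_zero,
        map_zero, zero_div, ZeroMemClass.coe_zero, map_zero]
  let η : Fin n → FunctionField k n := fun j =>
    (eulerDerivation k n i (i.succAbove j)).liftKaehlerDifferential ω
  let E : Fin n → localRing x := fun j => ⟨a * η j, hω.mul_lift_mem hx ha i (i.succAbove j)⟩
  have hE : ∀ j l, a ∣ localEulerDerivation x i (i.succAbove j) a * E l -
      localEulerDerivation x i (i.succAbove l) a * E j := by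
    intro j l
    -- This is da ∧ aω = a (d(aω) - a dω), in which both d(aω) and a dω are regular.
    refine ⟨localEulerDerivation x i (i.succAbove j) (E l) -
      localEulerDerivation x i (i.succAbove l) (E j) -
        ⟨_, hω.mul_sub_mem hx ha (hsa j) (hsa l)⟩, Subtype.ext ?_⟩
    simp only [AddSubgroupClass.coe_sub, MulMemClass.coe_mul, coe_localEulerDerivation, E, η,
      Derivation.leibniz, smul_eq_mul]
    ring
  have hPQ' : ∀ j, t ∣ Q' * E j - P' * (v * g * localEulerDerivation x i (i.succAbove j) t) := by
    intro j
    obtain ⟨U, hU⟩ := hPQ (i.succAbove j)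
    -- The power of xᵢ brings U to the degree e + d of the denominator xᵢ^e p.
    have hUh : (X i ^ (dh + 1) * U).IsHomogeneous (e + d) := by
      refine .of_mul_right hh hh0 ?_
      have h1 : X i ^ (dh + 1) * U * h = X i ^ dh * (Q * (X i * A (i.succAbove j))) -
          P * (G * X i ^ dh) * (X i * pderiv (i.succAbove j) h) := by
        linear_combination -X i ^ (dh + 1) * hU
      rw [h1]
      refine .sub ?_ ((hP.mul hGX).mul (hh.X_mul_pderiv _ _))
      rw [add_comm (e + d)]
      exact (isHomogeneous_X_pow i dh).mul (hQ.mul (isHomogeneous_X_mul hA hF _ _))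
    obtain ⟨w, hw⟩ := exists_localRing_eq_div x hUh ((isHomogeneous_X_pow i e).mul hp)
      (by rw [map_mul]; exact mul_ne_zero (hXi e) hp0)
    refine ⟨v * w, Subtype.ext (algebraMap_functionField_injective ?_)⟩
    have hη : ε (η j) = ι (X i) * (ι (A (i.succAbove j)) / ι (h * G)) := by
      rw [algebraMap_lift_eulerDerivation, ← hA, mul_div_cancel_left₀ _ hF0']
    have hU' := congrArg ι hU
    have hh0' := algebraMap_ratFun_ne_zero hh0
    have hG0' := algebraMap_ratFun_ne_zero (right_ne_zero_of_mul hF0)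
    have hEj : ε (E j) = ε v.1 * (ι (X i) * ι (A (i.succAbove j))) / ι p := by
      change ε (a * η j) = _
      rw [map_mul, hap, hη]
      field_simp
    have hδt : ε (localEulerDerivation x i (i.succAbove j) t : localRing x) =
        ι (X i) * ι (pderiv (i.succAbove j) h) / ι (X i ^ dh) := by
      rw [coe_localEulerDerivation, algebraMap_eulerDerivation, ht, ratPderiv_div _ _
        (pow_ne_zero _ (X_ne_zero i)), Derivation.leibniz_pow, pderiv_X_of_ne (hsa j).symm]
      simp only [smul_zero, mul_zero, sub_zero, map_mul, map_pow]
      field_simp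
    simp only [AddSubgroupClass.coe_sub, MulMemClass.coe_mul, map_sub, map_mul, hQ', hP', hEj, hδt,
      ht, hg, hw]
    simp only [map_mul, map_sub, map_pow] at hU' ⊢
    field_simp
    linear_combination ι (X i) * ι (X i) ^ dh * hU'
  subst hatg
  obtain ⟨m, hm⟩ := exists_pow_mem_integralRelationIdeal_of_etale q hq hym hδ
    (natCast_le_ringKrullDim_localRing hx) hz hf hE hPQ'
  obtain ⟨s, hs, hs'⟩ := exists_mul_mem_integralRelationIdeal hi ht hP' hQ' hm
  exact ⟨s, hs, m, hs'⟩

end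

/-! ### Integrality and constancy of the residue. -/

noncomputable section

universe u

section

variable {R K : Type*} [CommRing R] [Field K] [Algebra R K] [IsFractionRing R K]

/-- Division by Q^m gives s y^m = p(y) with deg p < m. An element becomes integral when multiplied
by the leading coefficient of an equation it satisfies. -/
theorem isIntegral_smul_of_mem_integralRelationIdeal {P Q s : R} {m : ℕ} (hQ : Q ≠ 0)
    (h : s * P ^ m ∈ integralRelationIdeal 0 P Q m) :
    IsIntegral R (s • (algebraMap R K P / algebraMap R K Q)) := by
  have hQ' : algebraMap R K Q ≠ 0 := (map_ne_zero_iff _ (IsFractionRing.injective R K)).2 hQ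
  set y : K := algebraMap R K P / algebraMap R K Q with hy
  have hP : algebraMap R K P = y * algebraMap R K Q := by rw [hy, div_mul_cancel₀ _ hQ']
  have claim : ∀ w ∈ integralRelationIdeal 0 P Q m, ∃ p ∈ Polynomial.degreeLT R m,
      algebraMap R K w = Polynomial.aeval y p * algebraMap R K Q ^ m := by
    intro w hw
    induction hw using Submodule.span_induction with
    | zero => exact ⟨0, zero_mem _, by simp⟩
    | add a b _ _ ha hb =>
      obtain ⟨p, hp, e⟩ := ha
      obtain ⟨p', hp', e'⟩ := hb
      exact ⟨p + p', add_mem hp hp', by rw [map_add, map_add, e, e', add_mul]⟩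
    | smul r a _ ha =>
      obtain ⟨p, hp, e⟩ := ha
      exact ⟨r • p, Submodule.smul_mem _ _ hp, by
        rw [smul_eq_mul, map_mul, map_smul, e, Algebra.smul_def, mul_assoc]⟩
    | mem a ha =>
      obtain rfl | ⟨j, hj, rfl⟩ := ha
      · exact ⟨0, zero_mem _, by simp⟩
      · refine ⟨Polynomial.X ^ j, Polynomial.mem_degreeLT.2 ?_, ?_⟩
        · exact (Polynomial.degree_X_pow_le j).trans_lt (Nat.cast_lt.2 hj)
        · have h1 : m = (m - j) + j := (Nat.sub_add_cancel (le_of_lt hj)).symm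
          rw [map_mul, map_pow, map_pow, hP, map_pow, Polynomial.aeval_X]
          conv_rhs => rw [h1]
          ring
  obtain rfl | hs := eq_or_ne s 0
  · rw [zero_smul]; exact isIntegral_zero
  obtain ⟨p, hp, e⟩ := claim _ h
  have h1 : Polynomial.aeval y (Polynomial.C s * Polynomial.X ^ m - p) = 0 := by
    apply mul_right_cancel₀ (pow_ne_zero m hQ')
    rw [map_sub, sub_mul, ← e, map_mul, map_mul, Polynomial.aeval_C, map_pow, map_pow, Polynomial.aeval_X, hP]
    ring
  have h2 := isIntegral_leadingCoeff_smul _ _ h1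
  rwa [Polynomial.leadingCoeff_sub_of_degree_lt
    ((Polynomial.mem_degreeLT.1 hp).trans_eq (Polynomial.degree_C_mul_X_pow m hs).symm), Polynomial.leadingCoeff_C_mul_X_pow] at h2

end

variable {k : Type u} [Field k] {n : ℕ}

theorem vanishingIdeal_zero_le {σ : Type*} {I : Ideal (MvPolynomial σ k)}
    (hI : ∀ i, X i ∈ I) : vanishingIdeal k {(0 : σ → k)} ≤ I := by
  intro p hp
  rw [mem_vanishingIdeal_singleton_iff] at hp
  have h : Ideal.Quotient.mkₐ k I = (Algebra.ofId k _).comp (aeval (0 : σ → k)) := by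
    apply MvPolynomial.algHom_ext
    intro i
    rw [AlgHom.comp_apply, aeval_X, Pi.zero_apply, map_zero]
    exact Ideal.Quotient.eq_zero_iff_mem.2 (hI i)
  rw [← Ideal.Quotient.eq_zero_iff_mem]
  exact (congrArg (fun g => g p) h).trans (by rw [AlgHom.comp_apply, hp, map_zero])

/-- The codimension condition concerns homogeneous primes and Q need not be one, so it is applied to
the homogeneous core of Q, a prime of height at most 2. As T consists of forms, some f in T is
outside Q. Some variable is outside Q as well, since the ideal of the origin has height n + 1 ≥ 3.
-/
theorem exists_notMem_of_codimAtLeast [IsAlgClosed k] {T : Set (CoordRing k n)}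
    (hT : ∀ f ∈ T, ∃ d : ℕ, f.IsHomogeneous d) (hcodim : CodimAtLeast T 3) (hn : 2 ≤ n)
    (Q : Ideal (CoordRing k n)) [Q.IsPrime]
    (hQ : Q.height ≤ 2) :
    ∃ x : Fin (n + 1) → k, x ≠ 0 ∧ (∃ f ∈ T, eval x f ≠ 0) ∧ ∀ p ∈ Q, eval x p = 0 := by
  classical
  let := gradedAlgebra (σ := Fin (n + 1)) (R := k)
  let P := (Q.homogeneousCore (homogeneousSubmodule (Fin (n + 1)) k)).toIdeal
  have hPQ : P ≤ Q := Ideal.toIdeal_homogeneousCore_le (homogeneousSubmodule (Fin (n + 1)) k) Q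
  have hP : P.IsPrime := Ideal.IsPrime.homogeneousCore ‹_›
  have hmem : ∀ {f : CoordRing k n} {d : ℕ}, f.IsHomogeneous d → f ∈ Q → f ∈ P := fun hf hfQ =>
    Ideal.mem_homogeneousCore_of_homogeneous_of_mem ⟨_, hf⟩ hfQ
  have hlt : Q.height < 3 := hQ.trans_lt (by norm_num)
  obtain ⟨i, hi⟩ : ∃ i, X i ∉ Q := by
    by_contra! hcon
    have h1 := (natCard_le_height_vanishingIdeal_singleton (0 : Fin (n + 1) → k)).trans
      (Ideal.height_mono (vanishingIdeal_zero_le hcon))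
    rw [Nat.card_eq_fintype_card, Fintype.card_fin] at h1
    have h2 : ((3 : ℕ) : ℕ∞) ≤ ((n + 1 : ℕ) : ℕ∞) := by exact_mod_cast Nat.succ_le_succ hn
    exact absurd (h2.trans h1) (not_le.2 hlt)
  obtain ⟨f, hfT, hfP⟩ : ∃ f ∈ T, f ∉ P := by
    by_contra! hcon
    refine absurd (hcodim P hP (fun f hf d => ?_) hcon ⟨i, fun h => hi (hPQ h)⟩)
      (not_le.2 ((Ideal.height_mono hPQ).trans_lt hlt))
    exact (mem_iff_homogeneousComponent_mem
      (Q.homogeneousCore (homogeneousSubmodule (Fin (n + 1)) k)).isHomogeneous f).1 hf d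
  obtain ⟨d, hf⟩ := hT f hfT
  obtain ⟨x, hx, hfx⟩ := exists_mem_forall_eval_eq_zero_of_notMem Q
    (f := f * X i) (fun h => ((‹Q.IsPrime›).mem_or_mem h).elim (fun h => hfP (hmem hf h)) hi)
  rw [map_mul, eval_X] at hfx
  exact ⟨x, fun h => right_ne_zero_of_mul hfx (by rw [h]; rfl),
    ⟨f, hfT, left_ne_zero_of_mul hfx⟩, hx⟩

section Quotient

variable {h P Q : CoordRing k n}

theorem isIntegral_div_quotient [IsAlgClosed k] {T : Set (CoordRing k n)}
    (hT : ∀ f ∈ T, ∃ d : ℕ, f.IsHomogeneous d) (hcodim : CodimAtLeast T 3) (hn : 2 ≤ n)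
    [(Ideal.span {h}).IsPrime] (hQ : ¬ h ∣ Q)
    (hx : ∀ x : Fin (n + 1) → k, x ≠ 0 → (∃ f ∈ T, eval x f ≠ 0) →
      ∃ s, eval x s ≠ 0 ∧ ∃ m, s * P ^ m ∈ integralRelationIdeal h P Q m) :
    IsIntegral (CoordRing k n ⧸ Ideal.span {h})
      (algebraMap _ (FractionRing (CoordRing k n ⧸ Ideal.span {h})) (Ideal.Quotient.mk (Ideal.span {h}) P) /
        algebraMap _ (FractionRing (CoordRing k n ⧸ Ideal.span {h})) (Ideal.Quotient.mk (Ideal.span {h}) Q)) := by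
  classical
  let π := Ideal.Quotient.mk (Ideal.span {h})
  have hπ : Function.Surjective π := Ideal.Quotient.mk_surjective
  have hπh : π h = 0 := Ideal.Quotient.eq_zero_iff_mem.2 (Ideal.mem_span_singleton_self h)
  have hQ0 : π Q ≠ 0 := fun h0 =>
    hQ (Ideal.mem_span_singleton.1 (Ideal.Quotient.eq_zero_iff_mem.1 h0))
  refine isIntegral_of_forall_minimalPrimes_span_singleton k fun r _ I hI => ?_
  obtain ⟨r, rfl⟩ := hπ r
  have hIp : I.IsPrime := hI.1.1
  -- A prime minimal over one element modulo h pulls back to a prime minimal over two elements, of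
  -- height at most 2 by Krull.
  have hmin : I.comap π ∈ (Ideal.span (({h, r} : Finset (CoordRing k n)) : Set _)).minimalPrimes := by
    have h1 : (Ideal.span {π r}).comap π =
        Ideal.span (({h, r} : Finset (CoordRing k n)) : Set (CoordRing k n)) := by
      rw [← Set.image_singleton, ← Ideal.map_span, Ideal.comap_map_of_surjective π hπ,
        ← RingHom.ker_eq_comap_bot, Ideal.mk_ker, Finset.coe_pair, Ideal.span_insert, sup_comm]
    rw [← h1, Ideal.comap_minimalPrimes_eq_of_surjective hπ]
    exact ⟨I, hI, rfl⟩
  have hheight : (I.comap π).height ≤ 2 :=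
    (Ideal.height_le_card_of_mem_minimalPrimes_span_finset hmin).trans
      (by exact_mod_cast Finset.card_le_two)
  obtain ⟨x, hx0, hxT, hxI⟩ := exists_notMem_of_codimAtLeast hT hcodim hn (I.comap π) hheight
  obtain ⟨s, hs, m, hm⟩ := hx x hx0 hxT
  refine ⟨π s, fun h => hs (hxI s h), isIntegral_smul_of_mem_integralRelationIdeal hQ0 (m := m) ?_⟩
  have h1 := Ideal.mem_map_of_mem π hm
  rwa [map_integralRelationIdeal, hπh, map_mul, map_pow] at h1

theorem exists_dvd_sub_C_mul_of_isIntegral [IsAlgClosed k] {dh e : ℕ} (hh : h.IsHomogeneous dh)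
    (hP : P.IsHomogeneous e) (hQ : Q.IsHomogeneous e) [(Ideal.span {h}).IsPrime] (hQ0 : ¬ h ∣ Q)
    (hint : IsIntegral (CoordRing k n ⧸ Ideal.span {h})
      (algebraMap _ (FractionRing (CoordRing k n ⧸ Ideal.span {h})) (Ideal.Quotient.mk (Ideal.span {h}) P) /
        algebraMap _ (FractionRing (CoordRing k n ⧸ Ideal.span {h})) (Ideal.Quotient.mk (Ideal.span {h}) Q))) :
    ∃ α : k, h ∣ P - C α * Q := by
  let π := Ideal.Quotient.mk (Ideal.span {h})
  have hπ : Function.Surjective π := Ideal.Quotient.mk_surjective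
  have hπ0 : ∀ {f}, π f = 0 ↔ h ∣ f := fun {f} =>
    Ideal.Quotient.eq_zero_iff_mem.trans Ideal.mem_span_singleton
  let K := FractionRing (CoordRing k n ⧸ Ideal.span {h})
  let φ : CoordRing k n →ₐ[k] K := (IsScalarTower.toAlgHom k (CoordRing k n ⧸ Ideal.span {h}) K).comp
    (Ideal.Quotient.mkₐ k (Ideal.span {h}))
  have hφ0 : ∀ {f}, φ f = 0 ↔ h ∣ f := fun {f} =>
    (map_eq_zero_iff _ (IsFractionRing.injective (CoordRing k n ⧸ Ideal.span {h}) K)).trans hπ0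
  have hQφ : φ Q ≠ 0 := fun h0 => hQ0 (hφ0.1 h0)
  obtain ⟨p, hp, hp0⟩ := hint
  change Polynomial.eval₂ _ (φ P / φ Q) p = 0 at hp0
  obtain ⟨g, rfl, hdeg, hg⟩ := Polynomial.lifts_and_natDegree_eq_and_monic
    (Polynomial.mem_lifts_of_surjective hπ p) hp
  rw [Polynomial.eval₂_map] at hp0
  change Polynomial.eval₂ (φ : CoordRing k n →+* K) (φ P / φ Q) g = 0 at hp0
  set m := g.natDegree with hm
  have hterm : ∀ (c : CoordRing k n) {j : ℕ}, j < m + 1 →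
      φ c * (φ P / φ Q) ^ j * φ Q ^ m = φ (c * (P ^ j * Q ^ (m - j))) := by
    intro c j hj
    have h1 : m = (m - j) + j := (Nat.sub_add_cancel (Nat.le_of_lt_succ hj)).symm
    rw [map_mul, map_mul, map_pow, map_pow]
    have h2 : φ Q ^ m = φ Q ^ (m - j) * φ Q ^ j := by rw [← pow_add, ← h1]
    rw [h2, div_pow, mul_assoc, mul_comm (φ Q ^ (m - j)), ← mul_assoc (_ / _),
      div_mul_cancel₀ _ (pow_ne_zero j hQφ)]
  have h1 : h ∣ ∑ j ∈ Finset.range (m + 1), g.coeff j * (P ^ j * Q ^ (m - j)) := by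
    rw [← hφ0, map_sum, ← zero_mul (φ Q ^ m), ← hp0, Polynomial.eval₂_eq_sum_range,
      Finset.sum_mul]
    exact Finset.sum_congr rfl fun j hj => (hterm _ (Finset.mem_range.1 hj)).symm
  -- Every P^j Q^(m-j) has degree e * m, so in that degree only the constant terms of the
  -- coefficients remain. As h is homogeneous, it divides this component. The result is a monic
  -- equation for P / Q over k.
  have h2 : h ∣ ∑ j ∈ Finset.range (m + 1), C (constantCoeff (g.coeff j)) *
      (P ^ j * Q ^ (m - j)) := by
    obtain ⟨c, hc⟩ := h1
    have h3 := hh.dvd_homogeneousComponent_mul c (0 + e * m)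
    rw [mul_comm c, ← hc, map_sum] at h3
    convert h3 using 1
    refine Finset.sum_congr rfl fun j hj => ?_
    have h4 : (P ^ j * Q ^ (m - j)).IsHomogeneous (e * m) := by
      have := (hP.pow j).mul (hQ.pow (m - j))
      rwa [← mul_add, Nat.add_sub_cancel' (Nat.le_of_lt_succ (Finset.mem_range.1 hj))] at this
    rw [h4.homogeneousComponent_mul, homogeneousComponent_zero, constantCoeff_eq]
  have h3 : IsIntegral k (φ P / φ Q) := by
    refine ⟨g.map constantCoeff, hg.map _, ?_⟩
    rw [Polynomial.eval₂_map, Polynomial.eval₂_eq_sum_range]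
    apply mul_right_cancel₀ (pow_ne_zero m hQφ)
    rw [zero_mul, ← hφ0.2 h2, map_sum, Finset.sum_mul]
    refine Finset.sum_congr rfl fun j hj => ?_
    rw [← hterm _ (Finset.mem_range.1 hj)]
    congr 2
  obtain ⟨α, hα⟩ := minpoly.mem_range_of_degree_eq_one k _
    (IsAlgClosed.degree_eq_one_of_irreducible k (minpoly.irreducible h3))
  refine ⟨α, hφ0.1 ?_⟩
  rw [map_sub, map_mul, sub_eq_zero, ← div_eq_iff hQφ, ← hα]
  exact (φ.commutes α).symm

/-- Up to a unit, h is the linear equation of a point x, so divisibility by h means vanishing at x,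
and α = P(x) / Q(x). -/
theorem exists_dvd_sub_C_mul_of_two_variables [IsAlgClosed k] {h P Q : CoordRing k 1} {dh e : ℕ}
    (hirr : Irreducible h) (hh : h.IsHomogeneous dh) (hP : P.IsHomogeneous e)
    (hQ : Q.IsHomogeneous e) (hQ0 : ¬ h ∣ Q) : ∃ α : k, h ∣ P - C α * Q := by
  obtain ⟨x, hx, hxh⟩ := exists_ne_zero_eval_eq_zero one_ne_zero hirr
  have hl := hh.dvd_of_eval_eq_zero hx hxh
  have hdvd : h ∣ C (x 0) * X 1 - C (x 1) * X 0 := by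
    refine ((hirr.dvd_iff.1 hl).resolve_left fun hu => ?_).dvd
    have := hu.map (eval x)
    simp [mul_comm] at this
  have hQx : eval x Q ≠ 0 := fun h0 => hQ0 (hdvd.trans (hQ.dvd_of_eval_eq_zero hx h0))
  refine ⟨eval x P / eval x Q, hdvd.trans
    (IsHomogeneous.dvd_of_eval_eq_zero (d := e) (hP.sub ?_) hx ?_)⟩
  · exact hQ.C_mul _
  · rw [map_sub, map_mul, eval_C, div_mul_cancel₀ _ hQx, sub_self]

end Quotient

end

/-! ### Logarithmic forms as combinations of the dlog hᵢ. -/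

noncomputable section

universe u

variable {k : Type u} [Field k] {n : ℕ}

local notation "ι" => algebraMap (CoordRing k n) (RatFun k n)

theorem IsHomogeneous.eq_zero_of_dvd {h p : CoordRing k n} {d e : ℕ} (hh : h.IsHomogeneous d)
    (hp : p.IsHomogeneous e) (hlt : e < d) (hdvd : h ∣ p) : p = 0 := by
  by_contra hp0
  obtain ⟨c, rfl⟩ := hdvd
  have h1 := hp.totalDegree hp0
  rw [totalDegree_mul_of_isDomain (left_ne_zero_of_mul hp0) (right_ne_zero_of_mul hp0),
    hh.totalDegree (left_ne_zero_of_mul hp0)] at h1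
  omega

theorem ne_zero_of_irreducible {h : CoordRing k n} {d : ℕ} (hh : h.IsHomogeneous d)
    (hirr : Irreducible h) : d ≠ 0 := by
  rintro rfl
  rw [← totalDegree_zero_iff_isHomogeneous, totalDegree_eq_zero_iff_eq_C] at hh
  have h0 : coeff 0 h ≠ 0 := fun h0 => hirr.ne_zero (by rw [hh, h0, map_zero])
  exact hirr.not_isUnit (by rw [hh]; exact (isUnit_iff_ne_zero.2 h0).map C)

theorem dlog_eq_sum (h : CoordRing k n) :
    dlog h = ∑ j, ((ι h)⁻¹ * ι (pderiv j h)) • D k (RatFun k n) (ι (X j)) := by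
  rw [eq_sum_lift_ratPderiv_smul (dlog h)]
  refine Finset.sum_congr rfl fun j _ => ?_
  rw [dlog, map_smul, Derivation.liftKaehlerDifferential_comp_D, ratPderiv_algebraMap, smul_eq_mul]

/-- α is the residue along h = 0, computed from one index j₀ with ∂h/∂x_{j₀} ≠ 0; this derivative is
not divisible by h, having smaller degree. The proportionality of the A j to the G ∂ⱼh modulo h
carries α to all indices. -/
theorem IsLogForm.exists_dvd_sub [IsAlgClosed k] {T : Set (CoordRing k n)}
    (hT : ∀ f ∈ T, ∃ d : ℕ, f.IsHomogeneous d) (hcodim : CodimAtLeast T 3) (hn : n ≠ 0)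
    {h G : CoordRing k n} {ω : RatForm k n} (hω : IsLogForm (h * G) ω)
    (hNC : ∀ x : Fin (n + 1) → k, x ≠ 0 → (∃ f ∈ T, eval x f ≠ 0) →
      IsNormalCrossingAt (h * G) x)
    {A : Fin (n + 1) → CoordRing k n} (hA : ∀ j, ι (h * G) * ratCoeff ω j = ι (A j)) {dh dG : ℕ}
    (hirr : Irreducible h) (hh : h.IsHomogeneous dh) (hG : G.IsHomogeneous dG) (hG0 : G ≠ 0)
    (hhG : ¬ h ∣ G) : ∃ α : k, ∀ j, h ∣ A j - C α * (G * pderiv j h) := by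
  have hprime : Prime h := hirr.prime
  have : (Ideal.span {h}).IsPrime := (Ideal.span_singleton_prime hirr.ne_zero).2 hprime
  obtain ⟨e, rfl⟩ := Nat.exists_eq_succ_of_ne_zero (ne_zero_of_irreducible hh hirr)
  obtain ⟨j₀, hj₀⟩ := exists_pderiv_ne_zero hirr
  obtain ⟨x, hx, hxh⟩ := exists_ne_zero_eval_eq_zero hn hirr
  have hF := hh.mul hG
  have hF0 := mul_ne_zero hirr.ne_zero hG0
  have hpd : ∀ j, (pderiv j h).IsHomogeneous e := fun j => hh.pderiv
  have hP : (A j₀).IsHomogeneous (e + dG) := isHomogeneous_of_add_one hA hF (by omega) j₀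
  have hQ : (G * pderiv j₀ h).IsHomogeneous (e + dG) := by
    rw [add_comm e]
    exact hG.mul (hpd j₀)
  have hQ0 : ¬ h ∣ G * pderiv j₀ h := fun hdvd => (hprime.dvd_or_dvd hdvd).elim hhG fun hdvd =>
    hj₀ (IsHomogeneous.eq_zero_of_dvd hh (hpd j₀) (Nat.lt_succ_self e) hdvd)
  have hPQ : ∀ j, h ∣ G * pderiv j₀ h * A j - A j₀ * (G * pderiv j h) := by
    intro j
    obtain ⟨c, hc⟩ :=
      dvd_mul_pderiv_sub_of_eval_eq_zero hA hF hω hF0 hprime (dvd_mul_right _ _) hx hxh j₀ j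
    simp only [Derivation.leibniz, smul_eq_mul] at hc
    exact ⟨c - A j * pderiv j₀ G + A j₀ * pderiv j G, by linear_combination hc⟩
  obtain ⟨α, hα⟩ : ∃ α : k, h ∣ A j₀ - C α * (G * pderiv j₀ h) := by
    obtain rfl | hn2 : n = 1 ∨ 2 ≤ n := by omega
    · exact exists_dvd_sub_C_mul_of_two_variables hirr hh hP hQ hQ0
    · exact exists_dvd_sub_C_mul_of_isIntegral hh hP hQ hQ0
        (isIntegral_div_quotient hT hcodim hn2 hQ0 fun x hx hxT =>
          (hNC x hx hxT).exists_mul_pow_mem hx hω hA hh hF hF0 hP hQ hPQ)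
  refine ⟨α, fun j => (hprime.dvd_or_dvd (a := G * pderiv j₀ h) ?_).resolve_left hQ0⟩
  have h1 : G * pderiv j₀ h * (A j - C α * (G * pderiv j h)) =
      (G * pderiv j₀ h * A j - A j₀ * (G * pderiv j h)) +
        (A j₀ - C α * (G * pderiv j₀ h)) * (G * pderiv j h) := by ring
  rw [h1]
  exact dvd_add (hPQ j) (hα.mul_right _)

theorem inHomogeneousCoords_eq_zero_of_zero (ω : RatForm k 0) : inHomogeneousCoords k 0 ω = 0 := by
  have h := sum_X_mul_ratCoeff ω
  rw [Fin.sum_univ_one] at h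
  rw [inHomogeneousCoords_eq_sum, Fin.sum_univ_one,
    (mul_eq_zero.1 h).resolve_left (algebraMap_ratFun_ne_zero (X_ne_zero 0)), zero_smul]

section Main

variable {l : ℕ} {h : Fin l → CoordRing k n} {deg : Fin l → ℕ} {ω : RatForm k n}
  {A : Fin (n + 1) → CoordRing k n} {α : Fin l → k}

theorem eq_sum_of_forall_dvd_sub (hh : ∀ i, (h i).IsHomogeneous (deg i))
    (hirr : ∀ i, Irreducible (h i)) (hne : ∀ i j, i ≠ j → ¬ Associated (h i) (h j))
    (hA : ∀ j, ι (∏ i, h i) * ratCoeff ω j = ι (A j))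
    (hα : ∀ i j, h i ∣ A j - C (α i) * ((∏ i' ∈ Finset.univ.erase i, h i') * pderiv j (h i)))
    (j : Fin (n + 1)) :
    A j = ∑ i, C (α i) * ((∏ i' ∈ Finset.univ.erase i, h i') * pderiv j (h i)) := by
  have hF : (∏ i, h i).IsHomogeneous (∑ i, deg i) := IsHomogeneous.prod _ _ _ fun i _ => hh i
  rw [← sub_eq_zero]
  -- Multiplied by X 0, the difference is homogeneous of degree deg F and divisible by F * X 0, of
  -- degree deg F + 1, so it is zero.
  refine (mul_eq_zero.1 (IsHomogeneous.eq_zero_of_dvd (hF.mul (isHomogeneous_X k 0))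
    (p := X 0 * (A j - ∑ i, C (α i) * ((∏ i' ∈ Finset.univ.erase i, h i') * pderiv j (h i))) )
    (e := ∑ i, deg i) ?_ (Nat.lt_succ_self _) ?_)).resolve_left (X_ne_zero 0)
  · rw [mul_sub, Finset.mul_sum]
    refine (isHomogeneous_X_mul hA hF 0 j).sub (IsHomogeneous.sum _ _ _ fun i hi => ?_)
    have h1 : X 0 * (C (α i) * ((∏ i' ∈ Finset.univ.erase i, h i') * pderiv j (h i))) =
        C (α i) * (X 0 * pderiv j (h i) * ∏ i' ∈ Finset.univ.erase i, h i') := by ring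
    rw [h1, ← Finset.add_sum_erase _ _ hi]
    exact (((hh i).X_mul_pderiv 0 j).mul (IsHomogeneous.prod _ _ _ fun i _ => hh i)).C_mul _
  · rw [mul_comm]
    refine mul_dvd_mul_left _ (Finset.prod_dvd_of_isRelPrime (fun i _ i' _ hi => ?_) fun i _ => ?_)
    · exact (hirr i).isRelPrime_iff_not_dvd.2 fun hd =>
        hne i i' hi ((hirr i).associated_of_dvd (hirr i') hd)
    -- Modulo h i only the i-th summand survives, and it is the one in `hα`.
    · rw [← Finset.add_sum_erase _ _ (Finset.mem_univ i), ← sub_sub]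
      refine dvd_sub (hα i j) (Finset.dvd_sum fun i' hi' => Dvd.dvd.mul_left
        (Dvd.dvd.mul_right (Finset.dvd_prod_of_mem _ ?_) _) _)
      exact Finset.mem_erase.2 ⟨(Finset.ne_of_mem_erase hi').symm, Finset.mem_univ _⟩

theorem sum_mul_deg_eq_zero (hh : ∀ i, (h i).IsHomogeneous (deg i))
    (h0 : ∏ i, h i ≠ 0) (hA : ∀ j, ι (∏ i, h i) * ratCoeff ω j = ι (A j))
    (hα : ∀ j, A j = ∑ i, C (α i) * ((∏ i' ∈ Finset.univ.erase i, h i') * pderiv j (h i))) :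
    ∑ i, α i * (deg i : k) = 0 := by
  have h1 := sum_X_mul_eq_zero hA
  simp only [hα, Finset.mul_sum] at h1
  rw [Finset.sum_comm] at h1
  have h2 : ∀ i, ∑ j, X j * (C (α i) * ((∏ i' ∈ Finset.univ.erase i, h i') * pderiv j (h i))) =
      C (α i * (deg i : k)) * ∏ i, h i := by
    intro i
    have h3 : ∀ j, X j * (C (α i) * ((∏ i' ∈ Finset.univ.erase i, h i') * pderiv j (h i))) =
      C (α i) * (∏ i' ∈ Finset.univ.erase i, h i') * (X j * pderiv j (h i)) := fun j => by ring
    simp only [h3]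
    rw [← Finset.mul_sum, (hh i).sum_X_mul_pderiv, ← Finset.mul_prod_erase _ _ (Finset.mem_univ i),
      map_mul, map_natCast, nsmul_eq_mul]
    ring
  simp only [h2] at h1
  rw [← Finset.sum_mul, ← map_sum] at h1
  exact (map_eq_zero_iff _ (C_injective _ _)).1 ((mul_eq_zero.1 h1).resolve_right h0)

theorem inHomogeneousCoords_eq_sum_dlog (h0 : ∏ i, h i ≠ 0)
    (hA : ∀ j, ι (∏ i, h i) * ratCoeff ω j = ι (A j))
    (hα : ∀ j, A j = ∑ i, C (α i) * ((∏ i' ∈ Finset.univ.erase i, h i') * pderiv j (h i))) :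
    inHomogeneousCoords k n ω = ∑ i, α i • dlog (h i) := by
  have hρ : ∀ j, ratCoeff ω j = ∑ i, ι (C (α i)) * ((ι (h i))⁻¹ * ι (pderiv j (h i))) := by
    intro j
    have h0' := algebraMap_ratFun_ne_zero h0
    apply mul_left_cancel₀ h0'
    rw [hA, hα, map_sum, Finset.mul_sum]
    refine Finset.sum_congr rfl fun i _ => ?_
    rw [← Finset.mul_prod_erase _ _ (Finset.mem_univ i)] at h0 ⊢
    have h1 := algebraMap_ratFun_ne_zero (left_ne_zero_of_mul h0)
    rw [map_mul, map_mul, map_mul]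
    field_simp
  rw [inHomogeneousCoords_eq_sum]
  simp only [hρ, dlog_eq_sum, Finset.sum_smul, Finset.smul_sum]
  rw [Finset.sum_comm]
  refine Finset.sum_congr rfl fun i _ => Finset.sum_congr rfl fun j _ => ?_
  rw [mul_smul, ← algebraMap_smul (RatFun k n) (α i),
    IsScalarTower.algebraMap_apply k (CoordRing k n) (RatFun k n)]
  rfl

end Main

end

end LogForms

theorem mainTheorem12 {k : Type*} [Field k] [IsAlgClosed k] (n l : ℕ)
    (h : Fin l → MvPolynomial (Fin (n + 1)) k) (deg : Fin l → ℕ)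
    (h_homogeneous : ∀ i, (h i).IsHomogeneous (deg i))
    (h_irreducible : ∀ i, Irreducible (h i))
    (h_distinct : ∀ i j, i ≠ j → ¬ Associated (h i) (h j))
    (h_normalCrossing : LogForms.IsNormalCrossingInCodimTwo (∏ i, h i))
    (ω : LogForms.RatForm k n) (hω : LogForms.IsLogForm (∏ i, h i) ω) :
    ∃ c : Fin l → k, ∑ i, c i * (deg i : k) = 0 ∧
      LogForms.inHomogeneousCoords k n ω = ∑ i, c i • LogForms.dlog (h i) := by
  -- Projective 0-space is a point: every form on it is zero, and c = 0 works.
  obtain rfl | hn := eq_or_ne n 0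
  · exact ⟨0, by simp, by simp [LogForms.inHomogeneousCoords_eq_zero_of_zero]⟩
  obtain ⟨T, hT, hcodim, hNC⟩ := h_normalCrossing
  have h0 : ∏ i, h i ≠ 0 := Finset.prod_ne_zero_iff.2 fun i _ => (h_irreducible i).ne_zero
  choose A hA using hω.exists_mul_ratCoeff_eq
    (MvPolynomial.IsHomogeneous.prod _ _ _ fun i _ => h_homogeneous i) hn
  have key : ∀ i, ∃ α : k, ∀ j, h i ∣ A j -
      MvPolynomial.C α * ((∏ i' ∈ Finset.univ.erase i, h i') * MvPolynomial.pderiv j (h i)) := by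
    intro i
    rw [← Finset.mul_prod_erase _ _ (Finset.mem_univ i)] at hω hNC hA h0
    refine hω.exists_dvd_sub hT hcodim hn hNC hA (h_irreducible i) (h_homogeneous i)
      (MvPolynomial.IsHomogeneous.prod _ _ _ fun i _ => h_homogeneous i)
      (right_ne_zero_of_mul h0) fun hdvd => ?_
    obtain ⟨i', hi', hd⟩ := ((h_irreducible i).prime.dvd_finsetProd_iff _).1 hdvd
    exact h_distinct i i' (Finset.ne_of_mem_erase hi').symm
      ((h_irreducible i).associated_of_dvd (h_irreducible i') hd)
  choose α hα using key
  have hsum := LogForms.eq_sum_of_forall_dvd_sub h_homogeneous h_irreducible h_distinct hA hα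
  exact ⟨α, LogForms.sum_mul_deg_eq_zero h_homogeneous h0 hA hsum,
    LogForms.inHomogeneousCoords_eq_sum_dlog h0 hA hsum⟩
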